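/- Let $\mathcal H\neq\{0\}$ be a real Hilbert space of finite or countably infinite dimension $d$, let $\mathcal D$ be a distribution of pairs $(x,y)\in\mathcal H\times\mathbb R$ with $\mathbb E[y^2]<\infty$, let $L(w)=\frac12\mathbb E_{(x,y)\sim\mathcal D}[(y-\langle w,x\rangle)^2]$ be the risk, and let $w_*$ be a minimizer of $L$. Assume: 1. (Second moment) $H=\mathbb E[xx^\top]$ exists and has finite trace, and there are an orthonormal basis $(e_i)_{1\le i\le d}$ of $\mathcal H$ and $\lambda_1\ge\lambda_2\ge\dots>0$ with $He_i=\lambda_ie_i$. Write $(v)_i=\langle e_i,v\rangle$. 2. (Fourth moment, upper bound) The fourth moment of $x$ is finite, and $\psi>0$ is such that $\mathbb E[xx^\top Axx^\top]\preceq\psi\,\mathrm{tr}(HA)\,H$ for every bounded positive semidefinite operator $A$. 3. (Weak noise) With $\xi=y-\langle w_*,x\rangle$, the operator $\Sigma=\mathbb E[\xi^2xx^\top]$ exists, $H^{-1/2}\Sigma H^{-1/2}$ is bounded, and $\sigma^2=\|H^{-1/2}\Sigma H^{-1/2}\|$ (operator norm). Let $(x_t,y_t)_{t\ge1}$ be i.i.d.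 samples from $\mathcal D$. Fix $w_0\in\mathcal H$, $\delta>0$, $\alpha\in(0,1)$ and $N\in\mathbb N$, and set $$w_t=w_{t-1}+\delta(y_t-\langle w_{t-1},x_t\rangle)x_t,\qquad \overline w_0=w_0,\qquad \overline w_t=\alpha\overline w_{t-1}+(1-\alpha)w_{t-1}\qquad(t\ge1).$$ Suppose $N(1-\alpha)\ge1$ and $\delta<1/(\psi\,\mathrm{tr}(H))$. Let $k^*=\max\{i:\lambda_i\ge(1-\alpha)/\delta\}$ and $k^\dagger=\max\{i:\lambda_i\ge1/(N\delta)\}$ (with $\max\emptyset=0$), and $$b_i=\frac{\delta\lambda_i\alpha^N-(1-\alpha)(1-\delta\lambda_i)^N}{\delta\lambda_i-(1-\alpha)},$$ where $b_i=\alpha^N+N(1-\alpha)\alpha^{N-1}$, the limit value, if $\delta\lambda_i=1-\alpha$. Then $L(\overline w_N)$ is integrable and $$\mathbb E[L(\overline w_N)]-L(w_*)\le\mathrm{EffectiveBias}+\mathrm{EffectiveVar},$$ where $$\mathrm{EffectiveBias}=\sum_{i=1}^d(w_0-w_*)_i^2\,\lambda_i\,b_i^2$$ and $$\begin{aligned}\mathrm{EffectiveVar}={}&\Big[k^*(1-\alpha)^2+\delta^2\sum_{i>k^*}\lambda_i^2\Big]\cdot\frac{\psi\Big(\sum_{i\le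 k^\dagger}(w_0-w_*)_i^2+N\delta\sum_{i>k^\dagger}\lambda_i(w_0-w_*)_i^2\Big)}{\delta(1-\psi\delta\,\mathrm{tr}(H))}\\&+\frac{\sigma^2}{1-\psi\delta\,\mathrm{tr}(H)}\Big[(1-\alpha)k^*+\delta\sum_{i=k^*+1}^{k^\dagger}\lambda_i+N\delta^2\sum_{i>k^\dagger}\lambda_i^2\Big].\end{aligned}$$ -/

import Mathlib

open MeasureTheory ProbabilityTheory
open scoped InnerProductSpace

namespace EMA

noncomputable section

/-- The index set `{1, …, d}` of a space of dimension `d`, where `d = ⊤` gives `{1, 2, 3, …}`. -/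
abbrev Idx (d : ℕ∞) : Type := {i : ℕ // 1 ≤ i ∧ (i : ℕ∞) ≤ d}

section Model

variable {E : Type*} [NormedAddCommGroup E] [InnerProductSpace ℝ E] [MeasurableSpace E]

/-- The risk `L(w) = ½ E (y - ⟨w, x⟩)²` under the data distribution `D`. -/
def risk (D : Measure (E × ℝ)) (w : E) : ℝ :=
  1 / 2 * ∫ p, (p.2 - ⟪w, p.1⟫_ℝ) ^ 2 ∂D

/-- The covariance operator `H = E[x xᵀ]`. -/
def covOp (D : Measure (E × ℝ)) : E →L[ℝ] E :=
  ∫ p, InnerProductSpace.rankOne ℝ p.1 p.1 ∂D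

/-- The fourth moment operator applied to `A`, that is `M ∘ A = E[x xᵀ A x xᵀ]`. -/
def fourthOp (D : Measure (E × ℝ)) (A : E →L[ℝ] E) : E →L[ℝ] E :=
  ∫ p, InnerProductSpace.rankOne ℝ p.1 p.1 ∘L A ∘L InnerProductSpace.rankOne ℝ p.1 p.1 ∂D

/-- The covariance `Σ = E[ξ² x xᵀ]` of the stochastic gradient at `ws`, where
`ξ = y - ⟨ws, x⟩`. -/
def gradCov (D : Measure (E × ℝ)) (ws : E) : E →L[ℝ] E :=
  ∫ p, (p.2 - ⟪ws, p.1⟫_ℝ) ^ 2 • InnerProductSpace.rankOne ℝ p.1 p.1 ∂D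

/-- The trace of an operator, computed in an orthonormal basis. -/
def opTrace {ι : Type*} (e : HilbertBasis ι ℝ E) (T : E →L[ℝ] E) : ℝ :=
  ∑' i, ⟪e i, T (e i)⟫_ℝ

/-- Second-moment assumption: `H = E[x xᵀ]` exists, it is diagonal in the orthonormal basis `e` with
positive eigenvalues `lam` in descending order, and its trace is finite. -/
structure SecondMoment {d : ℕ∞} (D : Measure (E × ℝ)) (e : HilbertBasis (Idx d) ℝ E)
    (lam : Idx d → ℝ) : Prop where
  integrable_sq : Integrable (fun p : E × ℝ => ‖p.1‖ ^ 2) D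
  eigen : ∀ i, covOp D (e i) = lam i • e i
  antitone : Antitone lam
  summable : Summable lam
  pos : ∀ i, 0 < lam i

/-- Fourth-moment assumption (upper bound) with constant `ψ`: the fourth moment is finite and
`E[x xᵀ A x xᵀ] ⪯ ψ tr(H A) H` for every positive semidefinite `A`. -/
structure FourthMoment {ι : Type*} (D : Measure (E × ℝ)) (e : HilbertBasis ι ℝ E) (ψ : ℝ) :
    Prop where
  integrable_fourth : Integrable (fun p : E × ℝ => ‖p.1‖ ^ 4) D
  psi_pos : 0 < ψ
  le : ∀ A : E →L[ℝ] E, A.IsPositive →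
    ((ψ * opTrace e (covOp D ∘L A)) • covOp D - fourthOp D A).IsPositive

/-- Weak label noise assumption with noise level `σ²`: the operator `Σ = E[ξ² x xᵀ]` exists,
`H^(-1/2) Σ H^(-1/2)` is a bounded operator `S` (its matrix in the eigenbasis `e` of `H` is
`(Σ_{ij} / √(λ_i λ_j))`), and `σ²` is the operator norm of `S`. -/
structure WeakNoise {ι : Type*} (D : Measure (E × ℝ)) (ws : E) (e : HilbertBasis ι ℝ E)
    (lam : ι → ℝ) (σ : ℝ) : Prop where
  integrable_noise :
    Integrable (fun p : E × ℝ => (p.2 - ⟪ws, p.1⟫_ℝ) ^ 2 * ‖p.1‖ ^ 2) D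
  level : ∃ S : E →L[ℝ] E,
    (∀ i j, ⟪e i, S (e j)⟫_ℝ = (√(lam i))⁻¹ * ⟪e i, gradCov D ws (e j)⟫_ℝ * (√(lam j))⁻¹) ∧
    σ ^ 2 = ‖S‖

end Model

section Algorithm

variable {E : Type*} [NormedAddCommGroup E] [InnerProductSpace ℝ E]

/-- SGD iterates `w_t = w_{t-1} + δ (y_t - ⟨w_{t-1}, x_t⟩) x_t` along the samples
`z t = (x_t, y_t)`, `t ≥ 1`. -/
def sgd (δ : ℝ) (w0 : E) (z : ℕ → E × ℝ) : ℕ → E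
  | 0 => w0
  | t + 1 => sgd δ w0 z t +
      (δ * ((z (t + 1)).2 - ⟪sgd δ w0 z t, (z (t + 1)).1⟫_ℝ)) • (z (t + 1)).1

/-- Exponential moving average of a sequence `w`: `w̄_0 = w_0` and
`w̄_t = α w̄_{t-1} + (1 - α) w_{t-1}`. -/
def ema (α : ℝ) (w : ℕ → E) : ℕ → E
  | 0 => w 0
  | t + 1 => α • ema α w t + (1 - α) • w t

end Algorithm

section Bound

variable {d : ℕ∞}

/-- `max {i : λ_i ≥ c}`, with the value `0` if there is no such index. -/
def cutoff (lam : Idx d → ℝ) (c : ℝ) : ℕ :=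
  sSup {k : ℕ | ∃ i : Idx d, (i : ℕ) = k ∧ c ≤ lam i}

/-- The decay rate `b = (δl α^N - (1-α)(1-δl)^N) / (δl - (1-α))` in an eigenspace with eigenvalue
`l`, extended continuously to `δl = 1 - α`. -/
def decay (δ α : ℝ) (N : ℕ) (l : ℝ) : ℝ :=
  if δ * l = 1 - α then α ^ N + N * (1 - α) * α ^ (N - 1)
  else (δ * l * α ^ N - (1 - α) * (1 - δ * l) ^ N) / (δ * l - (1 - α))

/-- `∑_i v_i² λ_i b_i²`, for `v = w_0 - w_*` given by its coordinates. -/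
def effectiveBias (lam v : Idx d → ℝ) (δ α : ℝ) (N : ℕ) : ℝ :=
  ∑' i, v i ^ 2 * lam i * decay δ α N (lam i) ^ 2

/-- `k* = max {i : λ_i ≥ (1 - α) / δ}`. -/
def kStar (lam : Idx d → ℝ) (δ α : ℝ) : ℕ := cutoff lam ((1 - α) / δ)

/-- `k† = max {i : λ_i ≥ 1 / (N δ)}`. -/
def kDagger (lam : Idx d → ℝ) (δ : ℝ) (N : ℕ) : ℕ := cutoff lam (1 / (N * δ))

/-- The upper bound of the effective variance; `trH` stands for `tr(H)`, and `v` for the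
coordinates of `w_0 - w_*`. -/
def varBound (lam v : Idx d → ℝ) (trH ψ σ δ α : ℝ) (N : ℕ) : ℝ :=
  (kStar lam δ α * (1 - α) ^ 2
      + δ ^ 2 * (∑' i : {i : Idx d // kStar lam δ α < (i : ℕ)}, lam i ^ 2))
    * (ψ * ((∑' i : {i : Idx d // (i : ℕ) ≤ kDagger lam δ N}, v i ^ 2)
          + N * δ * (∑' i : {i : Idx d // kDagger lam δ N < (i : ℕ)}, lam i * v i ^ 2))
        / (δ * (1 - ψ * δ * trH)))
  + σ ^ 2 / (1 - ψ * δ * trH)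
    * ((1 - α) * kStar lam δ α
      + δ * (∑' i : {i : Idx d // kStar lam δ α < (i : ℕ) ∧ (i : ℕ) ≤ kDagger lam δ N}, lam i)
      + N * δ ^ 2 * (∑' i : {i : Idx d // kDagger lam δ N < (i : ℕ)}, lam i ^ 2))

end Bound

end

end EMA

/-!
The error `w_t - w_*` is the sum of two processes driven by the same features `x_t`: the *bias*
process, which starts at `w_0 - w_*` and sees no noise, and the *noise* process, which starts at `0`
and sees the labels `ξ_t`. Since `½ ‖a + b‖² ≤ ‖a‖² + ‖b‖²` in the seminorm of `H`, it suffices to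
bound the second moments of both averages in each eigendirection `e i` of `H`.

Write `r = δ λ_i`, `q = 1 - r`. In the direction `e i` an iterate is multiplied by `q` and perturbed
by `δ` times the deviation of the stochastic gradient from its mean, which is uncorrelated with the
past. Hence the second moment of the average at time `N` is the square of the response to the
initial error, which is `decay`, plus the sum of the variances of the perturbations, weighted by
the squared responses `g_n = (1 - α) ∑_{j < n} α ^ (n - 1 - j) q ^ j` (`response`,
`integral_sq_inner_noisyAvg_le`). The fourth moment assumption, used only for operators `A` of
rank one, bounds the variance at time `t + 1` by `λ_i (ψ β_t + s)`, where `β_t = E ⟨u_t, H u_t⟩` and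
`s` is `0` or `σ²` (`integral_sq_step_le_of_indep`). The correlation between the noise and the
multiplicative part of the stochastic gradient vanishes since the bias process has no noise and the
noise process has mean zero.

The same estimate turns the second moments of the coordinates of the iterates into a perturbed
linear recursion (`MomentRecursion`). For the noise process it keeps `ψ β_t + s` below
`s / (1 - ψ δ tr H)` (`MomentRecursion.gradient_variance_le`); for the bias process, summed over
time and over the spectrum, it bounds `∑_{t < N} β_t` in terms of `∑ i, min 1 (N r) (w_0 - w_*)_i²`
(`MomentRecursion.sum_risk_le`). With `r g_n ≤ min (1 - α) r` and
`∑_{n < N} (r g_n)² ≤ min (1 - α) (min r (N r²))`, summation over the spectrum gives both parts of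
the bound (`tsum_bias_le`, `tsum_noise_le`). Each of these minima is a minimum of bounds that hold
for every `i`, so the cutoffs `k*` and `k†` serve only to choose the better one. The condition
`δ λ_i ≤ 1` holds since `ψ ≥ 1`, which follows from the Cauchy–Schwarz inequality
(`one_le_of_fourthMoment`).
-/

namespace EMA

/-! ### Impulse response of the averaged recursion -/

/-- The response of `ema α u` after `n` steps to a unit impulse in `u`, when `u` is multiplied by
`q` in every step: `(1 - α) ∑_{j < n} α ^ (n - 1 - j) q ^ j`, in recursive form. -/
def response (α q : ℝ) : ℕ → ℝ
  | 0 => 0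
  | n + 1 => q * response α q n + (1 - α) * α ^ n

section Response

variable {α q : ℝ}

lemma response_nonneg (hα : 0 ≤ α) (hα1 : α ≤ 1) (hq : 0 ≤ q) (n : ℕ) : 0 ≤ response α q n := by
  induction n with
  | zero => simp [response]
  | succ n ih =>
    have := sub_nonneg.2 hα1
    rw [response]
    positivity

lemma pow_add_response_le_one (hα : 0 ≤ α) (hα1 : α ≤ 1) (hq : 0 ≤ q) (hq1 : q ≤ 1) (n : ℕ) :
    α ^ n + response α q n ≤ 1 := by
  induction n with
  | zero => simp [response]
  | succ n ih =>
    have h := mul_le_of_le_one_left (response_nonneg hα hα1 hq n) hq1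
    rw [response, pow_succ]
    linarith

lemma response_le_one (hα : 0 ≤ α) (hα1 : α ≤ 1) (hq : 0 ≤ q) (hq1 : q ≤ 1) (n : ℕ) :
    response α q n ≤ 1 := by
  linarith [pow_add_response_le_one hα hα1 hq hq1 n, pow_nonneg hα n]

lemma mul_response_le (hα : 0 ≤ α) (hα1 : α ≤ 1) (hq : 0 ≤ q) (hq1 : q ≤ 1) (n : ℕ) :
    (1 - q) * response α q n ≤ 1 - α := by
  induction n with
  | zero => simpa [response] using hα1
  | succ n ih =>
    have h1 := mul_le_mul_of_nonneg_left ih hq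
    have h2 := mul_le_of_le_one_right
      (mul_nonneg (sub_nonneg.2 hq1) (sub_nonneg.2 hα1)) (pow_le_one₀ hα hα1 (n := n))
    rw [response]
    linarith

lemma mul_sum_response_le_one (hα : 0 ≤ α) (hα1 : α ≤ 1) (hq : 0 ≤ q) (N : ℕ) :
    (1 - q) * ∑ n ∈ Finset.range N, response α q n ≤ 1 := by
  have key : (1 - q) * ∑ n ∈ Finset.range N, response α q n = 1 - α ^ N - response α q N := by
    induction N with
    | zero => simp [response]
    | succ n ih => rw [Finset.sum_range_succ, mul_add, ih, response]; ring
  linarith [pow_nonneg hα N, response_nonneg hα hα1 hq N]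

lemma sub_mul_response (n : ℕ) : (α - q) * response α q n = (1 - α) * (α ^ n - q ^ n) := by
  induction n with
  | zero => simp [response]
  | succ n ih => rw [response, mul_add, mul_left_comm, ih]; ring

lemma response_self (n : ℕ) : response α α n = n * (1 - α) * α ^ (n - 1) := by
  induction n with
  | zero => simp [response]
  | succ n ih =>
    rw [response, ih]
    rcases n with _ | n
    · simp
    · simp only [Nat.add_sub_cancel]; push_cast; ring

/-- The decay rate of the averaged iterate is the response to the initial error, which enters both
the average and the iterate. -/
lemma decay_eq (δ α : ℝ) (N : ℕ) (l : ℝ) : decay δ α N l = α ^ N + response α (1 - δ * l) N := by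
  unfold decay
  split_ifs with h
  · rw [h, sub_sub_cancel, response_self]
  · have h' : δ * l - (1 - α) ≠ 0 := sub_ne_zero.2 h
    rw [div_eq_iff h']
    have := sub_mul_response (α := α) (q := 1 - δ * l) N
    linear_combination -this

lemma sq_mul_response_le (hα : 0 ≤ α) (hα1 : α ≤ 1) (hq : 0 ≤ q) (hq1 : q ≤ 1) (n : ℕ) :
    ((1 - q) * response α q n) ^ 2 ≤ (1 - α) ^ 2 :=
  pow_le_pow_left₀ (mul_nonneg (sub_nonneg.2 hq1) (response_nonneg hα hα1 hq n))
    (mul_response_le hα hα1 hq hq1 n) 2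

lemma sq_mul_response_le' (hα : 0 ≤ α) (hα1 : α ≤ 1) (hq : 0 ≤ q) (hq1 : q ≤ 1) (n : ℕ) :
    ((1 - q) * response α q n) ^ 2 ≤ (1 - q) ^ 2 :=
  pow_le_pow_left₀ (mul_nonneg (sub_nonneg.2 hq1) (response_nonneg hα hα1 hq n))
    (mul_le_of_le_one_right (sub_nonneg.2 hq1) (response_le_one hα hα1 hq hq1 n)) 2

lemma sum_sq_mul_response_le_of_le {c : ℝ} (hα : 0 ≤ α) (hα1 : α ≤ 1) (hq : 0 ≤ q) (hq1 : q ≤ 1)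
    (hc : 0 ≤ c) (h : ∀ n, (1 - q) * response α q n ≤ c) (N : ℕ) :
    ∑ n ∈ Finset.range N, ((1 - q) * response α q n) ^ 2 ≤ c := by
  calc ∑ n ∈ Finset.range N, ((1 - q) * response α q n) ^ 2
      ≤ ∑ n ∈ Finset.range N, c * ((1 - q) * response α q n) := by
        refine Finset.sum_le_sum fun n _ => ?_
        rw [sq]
        exact mul_le_mul_of_nonneg_right (h n)
          (mul_nonneg (sub_nonneg.2 hq1) (response_nonneg hα hα1 hq n))
    _ = c * ((1 - q) * ∑ n ∈ Finset.range N, response α q n) := by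
        rw [← Finset.mul_sum, ← Finset.mul_sum]
    _ ≤ c := mul_le_of_le_one_right hc (mul_sum_response_le_one hα hα1 hq N)

lemma sum_sq_mul_response_le (hα : 0 ≤ α) (hα1 : α ≤ 1) (hq : 0 ≤ q) (hq1 : q ≤ 1) (N : ℕ) :
    ∑ n ∈ Finset.range N, ((1 - q) * response α q n) ^ 2 ≤ 1 - α :=
  sum_sq_mul_response_le_of_le hα hα1 hq hq1 (sub_nonneg.2 hα1) (mul_response_le hα hα1 hq hq1) N

lemma sum_sq_mul_response_le' (hα : 0 ≤ α) (hα1 : α ≤ 1) (hq : 0 ≤ q) (hq1 : q ≤ 1) (N : ℕ) :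
    ∑ n ∈ Finset.range N, ((1 - q) * response α q n) ^ 2 ≤ 1 - q :=
  sum_sq_mul_response_le_of_le hα hα1 hq hq1 (sub_nonneg.2 hq1)
    (fun n => mul_le_of_le_one_right (sub_nonneg.2 hq1) (response_le_one hα hα1 hq hq1 n)) N

lemma sum_sq_mul_response_le_mul (hα : 0 ≤ α) (hα1 : α ≤ 1) (hq : 0 ≤ q) (hq1 : q ≤ 1) (N : ℕ) :
    ∑ n ∈ Finset.range N, ((1 - q) * response α q n) ^ 2 ≤ N * (1 - q) ^ 2 := by
  simpa using Finset.sum_le_card_nsmul (Finset.range N) _ _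
    fun n _ => sq_mul_response_le' hα hα1 hq hq1 n

end Response

/-! ### Perturbed linear recursions -/

section Recursion

variable {ρ r : ℝ} {c f : ℕ → ℝ}

lemma mul_sum_le_of_recursion (hρ : ρ ≤ 1 - r) (hc : ∀ t, 0 ≤ c t)
    (h : ∀ t, c (t + 1) ≤ ρ * c t + f t) (N : ℕ) :
    r * ∑ t ∈ Finset.range N, c t ≤ c 0 + ∑ t ∈ Finset.range N, f t := by
  have key : r * ∑ t ∈ Finset.range N, c t + c N ≤ c 0 + ∑ t ∈ Finset.range N, f t := by
    induction N with
    | zero => simp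
    | succ n ih =>
      rw [Finset.sum_range_succ, Finset.sum_range_succ]
      linarith [h n, mul_le_mul_of_nonneg_right hρ (hc n)]
  linarith [hc N]

/-- The bound of the partial sums that is sharp for small `N * r`. -/
lemma mul_sum_le_mul_of_recursion (hr : 0 ≤ r) (hr1 : r ≤ 1) (hρ : ρ ≤ 1 - r)
    (hc : ∀ t, 0 ≤ c t) (hf : ∀ t, 0 ≤ f t) (h : ∀ t, c (t + 1) ≤ ρ * c t + f t) (N : ℕ) :
    r * ∑ t ∈ Finset.range N, c t ≤ N * r * c 0 + ∑ t ∈ Finset.range N, f t := by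
  -- The excess of `c N` over `c 0` is carried along to close the induction.
  have key : r * ∑ t ∈ Finset.range N, c t + max (c N - c 0) 0
      ≤ N * r * c 0 + ∑ t ∈ Finset.range N, f t := by
    induction N with
    | zero => simp
    | succ n ih =>
      rw [Finset.sum_range_succ, Finset.sum_range_succ]
      push_cast
      have h1 := h n
      have h2 := mul_le_mul_of_nonneg_right hρ (hc n)
      have h3 := mul_nonneg hr (hc 0)
      have h4 := le_max_left (c n - c 0) 0
      have h5 := mul_le_of_le_one_left (le_max_right (c n - c 0) 0) hr1
      have h6 := mul_le_mul_of_nonneg_left h4 hr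
      have h7 := hf n
      rcases max_cases (c (n + 1) - c 0) 0 with ⟨e, -⟩ | ⟨e, -⟩ <;> rw [e] <;> linarith
  linarith [le_max_right (c N - c 0) 0]

end Recursion

/-! ### Second moments of the coordinates -/

/-- The inequalities that the second moments `c t i` of the coordinates of the iterates satisfy, for
stepsize `δ` and noise level `s`: a contraction by `(1 - δ λ_i) ^ 2`, plus the variance of the
stochastic gradient, which is driven by `∑ j, λ_j c t j`. -/
structure MomentRecursion {ι : Type*} (lam : ι → ℝ) (ψ δ s : ℝ) (c : ℕ → ι → ℝ) : Prop where
  nonneg : ∀ t i, 0 ≤ c t i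
  summable : ∀ t, Summable fun i => lam i * c t i
  step : ∀ t i, c (t + 1) i
    ≤ (1 - δ * lam i) ^ 2 * c t i + δ ^ 2 * lam i * (ψ * (∑' j, lam j * c t j) + s)

/-- The conditions on the spectrum and the stepsize. -/
structure Stepsize {ι : Type*} (lam : ι → ℝ) (ψ δ : ℝ) : Prop where
  summable : Summable lam
  nonneg : ∀ i, 0 ≤ lam i
  one_le : 1 ≤ ψ
  pos : 0 < δ
  lt_one : ψ * δ * (∑' i, lam i) < 1

section Moments

variable {ι : Type*} {lam : ι → ℝ} {ψ δ s : ℝ} {c : ℕ → ι → ℝ}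

lemma Stepsize.mul_nonneg (h : Stepsize lam ψ δ) (i : ι) : 0 ≤ δ * lam i :=
  _root_.mul_nonneg h.pos.le (h.nonneg i)

lemma Stepsize.mul_le_one (h : Stepsize lam ψ δ) (i : ι) : δ * lam i ≤ 1 := by
  have h1 : lam i ≤ ∑' j, lam j := h.summable.le_tsum i fun j _ => h.nonneg j
  have h2 := mul_le_mul_of_nonneg_left h1 h.pos.le
  have h3 : 0 ≤ δ * ∑' j, lam j := _root_.mul_nonneg h.pos.le (tsum_nonneg h.nonneg)
  have h4 := mul_le_mul_of_nonneg_right h.one_le h3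
  linarith [h.lt_one]

lemma Stepsize.summable_mul (h : Stepsize lam ψ δ) {f : ι → ℝ} {C : ℝ} (hf : ∀ i, 0 ≤ f i)
    (hC : ∀ i, f i ≤ C) : Summable fun i => lam i * f i :=
  Summable.of_nonneg_of_le (fun i => _root_.mul_nonneg (h.nonneg i) (hf i))
    (fun i => mul_le_mul_of_nonneg_left (hC i) (h.nonneg i)) (h.summable.mul_right C)

lemma Stepsize.summable_sq (h : Stepsize lam ψ δ) : Summable fun i => lam i ^ 2 := by
  simp_rw [sq]
  exact h.summable_mul (C := ∑' j, lam j) h.nonneg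
    fun i => h.summable.le_tsum i fun j _ => h.nonneg j

lemma Stepsize.one_sub_sq_le (h : Stepsize lam ψ δ) (i : ι) :
    (1 - δ * lam i) ^ 2 ≤ 1 - δ * lam i := by
  rw [sq]
  exact mul_le_of_le_one_left (sub_nonneg.2 (h.mul_le_one i)) (by linarith [h.mul_nonneg i])

/-- Without initial error, all second moments stay below `δ s / (1 - ψ δ tr H)`. -/
lemma MomentRecursion.le_of_zero (h : MomentRecursion lam ψ δ s c) (hl : Stepsize lam ψ δ)
    (hs : 0 ≤ s) (h0 : ∀ i, c 0 i = 0) (t : ℕ) (i : ι) :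
    c t i ≤ δ * s / (1 - ψ * δ * ∑' j, lam j) := by
  have hpos : 0 < 1 - ψ * δ * ∑' j, lam j := sub_pos.2 hl.lt_one
  set C := δ * s / (1 - ψ * δ * ∑' j, lam j) with hC
  have hC0 : 0 ≤ C := div_nonneg (mul_nonneg hl.pos.le hs) hpos.le
  have hCe : C * (1 - ψ * δ * ∑' j, lam j) = δ * s :=
    div_mul_cancel₀ _ hpos.ne'
  induction t generalizing i with
  | zero => rw [h0]; exact hC0
  | succ t ih =>
    have h1 : ∑' j, lam j * c t j ≤ (∑' j, lam j) * C := by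
      rw [← tsum_mul_right]
      exact (h.summable t).tsum_le_tsum
        (fun j => mul_le_mul_of_nonneg_left (ih j) (hl.nonneg j)) (hl.summable.mul_right C)
    have hψ : 0 ≤ ψ := zero_le_one.trans hl.one_le
    calc c (t + 1) i
        ≤ (1 - δ * lam i) ^ 2 * c t i + δ ^ 2 * lam i * (ψ * (∑' j, lam j * c t j) + s) :=
          h.step t i
      _ ≤ (1 - δ * lam i) * C + δ ^ 2 * lam i * (ψ * ((∑' j, lam j) * C) + s) := by
          have := hl.nonneg i
          have := ih i
          have := h.nonneg t i
          have := hl.one_sub_sq_le i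
          have := sub_nonneg.2 (hl.mul_le_one i)
          gcongr
      _ = C := by linear_combination -(δ * lam i) * hCe

lemma MomentRecursion.gradient_variance_le (h : MomentRecursion lam ψ δ s c)
    (hl : Stepsize lam ψ δ) (hs : 0 ≤ s) (h0 : ∀ i, c 0 i = 0) (t : ℕ) :
    ψ * (∑' j, lam j * c t j) + s ≤ s / (1 - ψ * δ * ∑' j, lam j) := by
  have hpos : 0 < 1 - ψ * δ * ∑' j, lam j := sub_pos.2 hl.lt_one
  have h1 : ∑' j, lam j * c t j ≤ (∑' j, lam j) * (δ * s / (1 - ψ * δ * ∑' j, lam j)) := by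
    rw [← tsum_mul_right]
    exact (h.summable t).tsum_le_tsum
      (fun j => mul_le_mul_of_nonneg_left (h.le_of_zero hl hs h0 t j) (hl.nonneg j))
      (hl.summable.mul_right _)
  have h2 := mul_le_mul_of_nonneg_left h1 (zero_le_one.trans hl.one_le)
  refine (add_le_add_left h2 s).trans_eq ?_
  rw [eq_div_iff hpos.ne', add_mul, mul_assoc, mul_assoc, div_mul_cancel₀ _ hpos.ne']
  ring

/-- Without noise, the total risk of the iterates before time `N` is controlled by the initial
error. In each coordinate either of the two estimates for recursions may be used, and `A` is the set
of coordinates where the one uniform in `N` is. -/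
lemma MomentRecursion.sum_risk_le (h : MomentRecursion lam ψ δ 0 c) (hl : Stepsize lam ψ δ)
    (A : Set ι) (h0 : Summable (c 0)) (N : ℕ) :
    ∑ t ∈ Finset.range N, ∑' j, lam j * c t j
      ≤ ((∑' i : A, c 0 i) + N * δ * ∑' i : ↥Aᶜ, lam i * c 0 i)
        / (δ * (1 - ψ * δ * ∑' j, lam j)) := by
  have hpos : 0 < 1 - ψ * δ * ∑' j, lam j := sub_pos.2 hl.lt_one
  rw [le_div_iff₀ (mul_pos hl.pos hpos)]
  set B := ∑ t ∈ Finset.range N, ∑' j, lam j * c t j with hB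
  have hβ : ∀ t, 0 ≤ ∑' j, lam j * c t j :=
    fun t => tsum_nonneg fun j => mul_nonneg (hl.nonneg j) (h.nonneg t j)
  have hψ : 0 ≤ ψ := zero_le_one.trans hl.one_le
  have hf : ∀ i t, 0 ≤ δ ^ 2 * lam i * (ψ * (∑' j, lam j * c t j) + 0) := fun i t => by
    have := hβ t
    have := hl.nonneg i
    positivity
  have hfs : ∀ i, ∑ t ∈ Finset.range N, δ ^ 2 * lam i * (ψ * (∑' j, lam j * c t j) + 0)
      = lam i * (δ ^ 2 * ψ * B) := fun i => by
    simp_rw [hB, Finset.mul_sum, add_zero]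
    exact Finset.sum_congr rfl fun t _ => by ring
  have hcoord : ∀ i, δ * lam i * ∑ t ∈ Finset.range N, c t i
      ≤ (A.indicator (c 0) i + N * δ * Aᶜ.indicator (fun i => lam i * c 0 i) i)
        + lam i * (δ ^ 2 * ψ * B) := fun i => by
    rw [← hfs i]
    by_cases hi : i ∈ A
    · simpa [hi] using mul_sum_le_of_recursion (hl.one_sub_sq_le i) (fun t => h.nonneg t i)
        (fun t => h.step t i) N
    · refine (mul_sum_le_mul_of_recursion (hl.mul_nonneg i) (hl.mul_le_one i) (hl.one_sub_sq_le i)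
        (fun t => h.nonneg t i) (hf i) (fun t => h.step t i) N).trans_eq ?_
      simp [hi]
      ring
  have hsum : HasSum (fun i => δ * lam i * ∑ t ∈ Finset.range N, c t i) (δ * B) := by
    have e : (fun i => δ * lam i * ∑ t ∈ Finset.range N, c t i)
        = fun i => δ * ∑ t ∈ Finset.range N, lam i * c t i := by
      funext i
      rw [mul_assoc, Finset.mul_sum]
    rw [e]
    exact (hasSum_sum fun t _ => (h.summable t).hasSum).mul_left δ
  have hS1 : Summable (A.indicator (c 0)) := h0.indicator A
  have hS2 : Summable (Aᶜ.indicator fun i => lam i * c 0 i) := (h.summable 0).indicator _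
  have hle := hasSum_le hcoord hsum
    ((hS1.hasSum.add (hS2.hasSum.mul_left (N * δ))).add (hl.summable.hasSum.mul_right (δ ^ 2 * ψ * B)))
  rw [tsum_subtype A (c 0), tsum_subtype Aᶜ fun i => lam i * c 0 i]
  linarith

end Moments

/-! ### Summation over the spectrum -/

section Spectrum

variable {d : ℕ∞} {lam m : Idx d → ℝ} {ψ δ α s : ℝ} {c : ℕ → Idx d → ℝ} {N : ℕ}

lemma card_idx_le (k : ℕ) : Nat.card {i : Idx d | (i : ℕ) ≤ k} ≤ k := by
  have h := Nat.card_le_card_of_injective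
    (fun i : {i : Idx d | (i : ℕ) ≤ k} =>
      (⟨i.1.1, Finset.mem_Icc.2 ⟨i.1.2.1, i.2⟩⟩ : Finset.Icc 1 k))
    fun i j h => by simpa [Subtype.ext_iff] using h
  rwa [Nat.card_eq_finsetCard, Nat.card_Icc, Nat.add_sub_cancel] at h

lemma finite_idx_le (k : ℕ) : {i : Idx d | (i : ℕ) ≤ k}.Finite :=
  Set.Finite.of_injOn (f := Subtype.val) (t := Set.Icc 1 k) (fun i hi => ⟨i.2.1, hi⟩)
    Subtype.val_injective.injOn (Set.finite_Icc 1 k)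

lemma hasSum_indicator_idx_le (k : ℕ) (x : ℝ) :
    HasSum ({i : Idx d | (i : ℕ) ≤ k}.indicator fun _ => x)
      (Nat.card {i : Idx d | (i : ℕ) ≤ k} * x) := by
  have hs : Summable ({i : Idx d | (i : ℕ) ≤ k}.indicator fun _ => x) :=
    summable_of_hasFiniteSupport ((finite_idx_le k).subset Set.support_indicator_subset)
  have h := hs.hasSum
  rwa [← tsum_subtype, tsum_const, nsmul_eq_mul] at h

/-- Summation of a function for which there is one estimate up to the index `k`, one from there to
`k'`, and one beyond `k'`. -/
lemma tsum_le_of_cutoffs {f g h : Idx d → ℝ} {x : ℝ} (k k' : ℕ) (hx : 0 ≤ x)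
    (hg : ∀ i, 0 ≤ g i) (hh : ∀ i, 0 ≤ h i) (hgs : Summable g) (hhs : Summable h)
    (hf : Summable f) (h1 : ∀ i, f i ≤ x) (h2 : ∀ i, f i ≤ g i) (h3 : ∀ i, f i ≤ h i) :
    ∑' i, f i ≤ k * x + (∑' i : {i : Idx d // k < (i : ℕ) ∧ (i : ℕ) ≤ k'}, g i)
      + ∑' i : {i : Idx d // k' < (i : ℕ)}, h i := by
  have hle : ∀ i, f i ≤ {i : Idx d | (i : ℕ) ≤ k}.indicator (fun _ => x) i
      + {i : Idx d | k < (i : ℕ) ∧ (i : ℕ) ≤ k'}.indicator g i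
      + {i : Idx d | k' < (i : ℕ)}.indicator h i := fun i => by
    have e1 : 0 ≤ {i : Idx d | (i : ℕ) ≤ k}.indicator (fun _ => x) i :=
      Set.indicator_nonneg (fun _ _ => hx) i
    have e2 : 0 ≤ {i : Idx d | k < (i : ℕ) ∧ (i : ℕ) ≤ k'}.indicator g i :=
      Set.indicator_nonneg (fun i _ => hg i) i
    have e3 : 0 ≤ {i : Idx d | k' < (i : ℕ)}.indicator h i :=
      Set.indicator_nonneg (fun i _ => hh i) i
    by_cases hk : (i : ℕ) ≤ k
    · rw [Set.indicator_of_mem (show i ∈ {i : Idx d | (i : ℕ) ≤ k} from hk)]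
      linarith [h1 i]
    by_cases hk' : (i : ℕ) ≤ k'
    · rw [Set.indicator_of_mem
        (show i ∈ {i : Idx d | k < (i : ℕ) ∧ (i : ℕ) ≤ k'} from ⟨not_le.1 hk, hk'⟩)]
      linarith [h2 i]
    · rw [Set.indicator_of_mem (show i ∈ {i : Idx d | k' < (i : ℕ)} from not_le.1 hk')]
      linarith [h3 i]
  have hcard := mul_le_mul_of_nonneg_right (Nat.cast_le (α := ℝ).2 (card_idx_le (d := d) k)) hx
  have := hasSum_le hle hf.hasSum (((hasSum_indicator_idx_le k x).add
    (hgs.indicator _).hasSum).add (hhs.indicator _).hasSum)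
  rw [← tsum_subtype, ← tsum_subtype] at this
  exact this.trans (add_le_add (add_le_add hcard le_rfl) le_rfl)

/-- The case of two estimates of `tsum_le_of_cutoffs`. -/
lemma tsum_le_of_cutoff {f h : Idx d → ℝ} {x : ℝ} (k : ℕ) (hx : 0 ≤ x)
    (hh : ∀ i, 0 ≤ h i) (hhs : Summable h)
    (hf : Summable f) (h1 : ∀ i, f i ≤ x) (h3 : ∀ i, f i ≤ h i) :
    ∑' i, f i ≤ k * x + ∑' i : {i : Idx d // k < (i : ℕ)}, h i := by
  have : IsEmpty {i : Idx d // k < (i : ℕ) ∧ (i : ℕ) ≤ k} := ⟨fun i => by have := i.2; omega⟩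
  simpa using tsum_le_of_cutoffs k k hx hh hh hhs hhs hf h1 h3 h3

lemma Stepsize.decay_sq_le_one (hl : Stepsize lam ψ δ) (hα : 0 ≤ α) (hα1 : α ≤ 1) (N : ℕ)
    (i : Idx d) : decay δ α N (lam i) ^ 2 ≤ 1 := by
  have hq := sub_nonneg.2 (hl.mul_le_one i)
  have hq1 : 1 - δ * lam i ≤ 1 := by linarith [hl.mul_nonneg i]
  rw [decay_eq]
  exact pow_le_one₀ (add_nonneg (pow_nonneg hα N) (response_nonneg hα hα1 hq N))
    (pow_add_response_le_one hα hα1 hq hq1 N)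

/-- The bias part of the risk of the averaged iterate, whose coordinates have second moments at most
`m`. -/
lemma tsum_bias_le {v : Idx d → ℝ} (hl : Stepsize lam ψ δ) (h : MomentRecursion lam ψ δ 0 c)
    (hα : 0 ≤ α) (hα1 : α ≤ 1) (hv : Summable fun i => v i ^ 2) (h0 : ∀ i, c 0 i = v i ^ 2)
    (hm : Summable fun i => lam i * m i)
    (hle : ∀ i, m i ≤ (decay δ α N (lam i) * v i) ^ 2
      + ∑ t ∈ Finset.range N, (δ * response α (1 - δ * lam i) (N - 1 - t)) ^ 2
        * (lam i * (ψ * (∑' j, lam j * c t j) + 0))) (k k' : ℕ) :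
    ∑' i, lam i * m i ≤ effectiveBias lam v δ α N
      + (k * (1 - α) ^ 2 + δ ^ 2 * ∑' i : {i : Idx d // k < (i : ℕ)}, lam i ^ 2)
        * (ψ * ((∑' i : {i : Idx d // (i : ℕ) ≤ k'}, v i ^ 2)
          + N * δ * (∑' i : {i : Idx d // k' < (i : ℕ)}, lam i * v i ^ 2))
        / (δ * (1 - ψ * δ * ∑' j, lam j))) := by
  set B := ∑ t ∈ Finset.range N, ∑' j, lam j * c t j with hB
  have hψ : 0 ≤ ψ := zero_le_one.trans hl.one_le
  have hβ : ∀ t, 0 ≤ ∑' j, lam j * c t j :=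
    fun t => tsum_nonneg fun j => mul_nonneg (hl.nonneg j) (h.nonneg t j)
  have hB0 : 0 ≤ B := Finset.sum_nonneg fun t _ => hβ t
  have hBle : B ≤ ((∑' i : {i : Idx d // (i : ℕ) ≤ k'}, v i ^ 2)
      + N * δ * (∑' i : {i : Idx d // k' < (i : ℕ)}, lam i * v i ^ 2))
        / (δ * (1 - ψ * δ * ∑' j, lam j)) := by
    have h0' : c 0 = fun i => v i ^ 2 := funext h0
    have := h.sum_risk_le hl {i : Idx d | (i : ℕ) ≤ k'} (h0' ▸ hv) N
    have hcompl : {i : Idx d | (i : ℕ) ≤ k'}ᶜ = {i : Idx d | k' < (i : ℕ)} := by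
      ext i; simp
    rw [hcompl, h0'] at this
    exact this
  have hvs : Summable fun i => v i ^ 2 * lam i * decay δ α N (lam i) ^ 2 := by
    refine Summable.of_nonneg_of_le
      (fun i => mul_nonneg (mul_nonneg (sq_nonneg _) (hl.nonneg i)) (sq_nonneg _))
      (fun i => mul_le_of_le_one_right (mul_nonneg (sq_nonneg _) (hl.nonneg i))
        (hl.decay_sq_le_one hα hα1 N i)) ?_
    simpa [h0, mul_comm] using h.summable 0
  -- The weight of the stochastic gradients in the coordinate `i`, uniformly in time.
  let f : Idx d → ℝ := fun i => min ((1 - α) ^ 2) ((δ * lam i) ^ 2)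
  have hsq : Summable fun i => (δ * lam i) ^ 2 := by
    simpa [mul_pow] using hl.summable_sq.mul_left (δ ^ 2)
  have hfs : Summable f := Summable.of_nonneg_of_le
    (fun i => le_min (sq_nonneg _) (sq_nonneg _)) (fun i => min_le_right _ _) hsq
  have hf : ∑' i, f i
      ≤ k * (1 - α) ^ 2 + δ ^ 2 * ∑' i : {i : Idx d // k < (i : ℕ)}, lam i ^ 2 := by
    refine (tsum_le_of_cutoff k (sq_nonneg _) (fun i => sq_nonneg _) hsq hfs
      (fun i => min_le_left _ _) fun i => min_le_right _ _).trans_eq ?_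
    simp_rw [mul_pow, tsum_mul_left]
  have hcoord : ∀ i, lam i * m i
      ≤ v i ^ 2 * lam i * decay δ α N (lam i) ^ 2 + f i * (ψ * B) := fun i => by
    have hq := sub_nonneg.2 (hl.mul_le_one i)
    have hq1 : 1 - δ * lam i ≤ 1 := by linarith [hl.mul_nonneg i]
    refine (mul_le_mul_of_nonneg_left (hle i) (hl.nonneg i)).trans ?_
    rw [mul_add]
    refine add_le_add (le_of_eq (by ring)) ?_
    rw [hB, Finset.mul_sum, Finset.mul_sum, Finset.mul_sum]
    refine Finset.sum_le_sum fun t _ => ?_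
    have e1 := sq_mul_response_le hα hα1 hq hq1 (N - 1 - t)
    have e2 := sq_mul_response_le' hα hα1 hq hq1 (N - 1 - t)
    rw [sub_sub_cancel] at e1 e2
    refine le_trans (le_of_eq ?_)
      (mul_le_mul_of_nonneg_right (le_min e1 e2) (mul_nonneg hψ (hβ t)))
    ring
  have hsum := hm.tsum_le_tsum hcoord (hvs.add (hfs.mul_right _))
  rw [hvs.tsum_add (hfs.mul_right _), tsum_mul_right] at hsum
  refine hsum.trans (add_le_add le_rfl ?_)
  rw [mul_div_assoc]
  have : 0 ≤ ∑' i, f i := tsum_nonneg fun i => le_min (sq_nonneg _) (sq_nonneg _)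
  exact mul_le_mul hf (mul_le_mul_of_nonneg_left hBle hψ) (mul_nonneg hψ hB0) (this.trans hf)

/-- The noise part of the risk of the averaged iterate, whose coordinates have second moments at
most `m`. -/
lemma tsum_noise_le (hl : Stepsize lam ψ δ) (h : MomentRecursion lam ψ δ s c) (hs : 0 ≤ s)
    (hα : 0 ≤ α) (hα1 : α ≤ 1) (h0 : ∀ i, c 0 i = 0)
    (hm : Summable fun i => lam i * m i)
    (hle : ∀ i, m i ≤ ∑ t ∈ Finset.range N, (δ * response α (1 - δ * lam i) (N - 1 - t)) ^ 2
        * (lam i * (ψ * (∑' j, lam j * c t j) + s))) (k k' : ℕ) :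
    ∑' i, lam i * m i ≤ s / (1 - ψ * δ * ∑' j, lam j)
      * ((1 - α) * k
        + δ * (∑' i : {i : Idx d // k < (i : ℕ) ∧ (i : ℕ) ≤ k'}, lam i)
        + N * δ ^ 2 * (∑' i : {i : Idx d // k' < (i : ℕ)}, lam i ^ 2)) := by
  set K := s / (1 - ψ * δ * ∑' j, lam j) with hK
  have hK0 : 0 ≤ K := div_nonneg hs (sub_pos.2 hl.lt_one).le
  let f : Idx d → ℝ := fun i =>
    ∑ n ∈ Finset.range N, (δ * lam i * response α (1 - δ * lam i) n) ^ 2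
  have hq := fun i => sub_nonneg.2 (hl.mul_le_one i)
  have hq1 : ∀ i, 1 - δ * lam i ≤ 1 := fun i => by linarith [hl.mul_nonneg i]
  have h1 : ∀ i, f i ≤ 1 - α := fun i => by
    simpa using sum_sq_mul_response_le hα hα1 (hq i) (hq1 i) N
  have h2 : ∀ i, f i ≤ δ * lam i := fun i => by
    simpa using sum_sq_mul_response_le' hα hα1 (hq i) (hq1 i) N
  have h3 : ∀ i, f i ≤ N * δ ^ 2 * lam i ^ 2 := fun i => by
    have := sum_sq_mul_response_le_mul hα hα1 (hq i) (hq1 i) N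
    rwa [sub_sub_cancel, mul_pow, ← mul_assoc] at this
  have hfs : Summable f := Summable.of_nonneg_of_le
    (fun i => Finset.sum_nonneg fun n _ => sq_nonneg _) h2 (hl.summable.mul_left δ)
  have hf := tsum_le_of_cutoffs k k' (sub_nonneg.2 hα1) hl.mul_nonneg
    (fun i => by positivity) (hl.summable.mul_left δ) (hl.summable_sq.mul_left (N * δ ^ 2)) hfs
    h1 h2 h3
  rw [tsum_mul_left, tsum_mul_left, mul_comm (k : ℝ)] at hf
  have hcoord : ∀ i, lam i * m i ≤ K * f i := fun i => by
    refine (mul_le_mul_of_nonneg_left (hle i) (hl.nonneg i)).trans ?_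
    rw [Finset.mul_sum, Finset.mul_sum,
      ← Finset.sum_range_reflect fun n => K * (δ * lam i * response α (1 - δ * lam i) n) ^ 2]
    refine Finset.sum_le_sum fun t _ => ?_
    refine le_trans (le_of_eq ?_)
      (mul_le_mul_of_nonneg_right (h.gradient_variance_le hl hs h0 t) (sq_nonneg _))
    ring
  refine (hm.tsum_le_tsum hcoord (hfs.mul_left K)).trans ?_
  rw [tsum_mul_left]
  exact mul_le_mul_of_nonneg_left hf hK0

end Spectrum

/-! ### Quadratic forms of the moment operators -/

section Operators

variable {E : Type*} [NormedAddCommGroup E] [InnerProductSpace ℝ E] [CompleteSpace E]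
  [SecondCountableTopology E] [MeasurableSpace E] [BorelSpace E]
  {D : Measure (E × ℝ)} {ι : Type*} {e : HilbertBasis ι ℝ E} {lam : ι → ℝ} {ψ σ : ℝ}

omit [CompleteSpace E] [SecondCountableTopology E] [MeasurableSpace E] [BorelSpace E] in
lemma continuous_rankOne_fst :
    Continuous fun p : E × ℝ => InnerProductSpace.rankOne ℝ p.1 p.1 :=
  ((ContinuousLinearMap.smulRightL ℝ E E).continuous.comp
    ((innerSL ℝ).continuous.comp continuous_fst)).clm_apply continuous_fst

omit [CompleteSpace E] in
lemma aestronglyMeasurable_of_continuous {φ : E × ℝ → E →L[ℝ] E} (hφ : Continuous φ) :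
    AEStronglyMeasurable φ D :=
  have : SecondCountableTopologyEither (E × ℝ) (E →L[ℝ] E) :=
    secondCountableTopologyEither_of_left _ _
  hφ.aestronglyMeasurable

omit [SecondCountableTopology E] [BorelSpace E] in
lemma integral_inner_apply {φ : E × ℝ → E →L[ℝ] E} (hφ : Integrable φ D) (u v : E) :
    ⟪u, (∫ p, φ p ∂D) v⟫_ℝ = ∫ p, ⟪u, φ p v⟫_ℝ ∂D := by
  rw [ContinuousLinearMap.integral_apply hφ, integral_inner (hφ.apply_continuousLinearMap v)]

lemma inner_covOp (h : Integrable (fun p : E × ℝ => ‖p.1‖ ^ 2) D) (u v : E) :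
    ⟪u, covOp D v⟫_ℝ = ∫ p, ⟪u, p.1⟫_ℝ * ⟪v, p.1⟫_ℝ ∂D := by
  have hi : Integrable (fun p : E × ℝ => InnerProductSpace.rankOne ℝ p.1 p.1) D :=
    Integrable.mono' h (aestronglyMeasurable_of_continuous continuous_rankOne_fst)
      (ae_of_all _ fun p => by rw [InnerProductSpace.norm_rankOne, sq])
  rw [covOp, integral_inner_apply hi]
  simp_rw [InnerProductSpace.rankOne_apply, inner_smul_right, real_inner_comm _ v, mul_comm]

lemma inner_gradCov {ws : E}
    (h : Integrable (fun p : E × ℝ => (p.2 - ⟪ws, p.1⟫_ℝ) ^ 2 * ‖p.1‖ ^ 2) D) (u v : E) :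
    ⟪u, gradCov D ws v⟫_ℝ
      = ∫ p, (p.2 - ⟪ws, p.1⟫_ℝ) ^ 2 * (⟪u, p.1⟫_ℝ * ⟪v, p.1⟫_ℝ) ∂D := by
  have hc : Continuous fun p : E × ℝ => (p.2 - ⟪ws, p.1⟫_ℝ) ^ 2 := by fun_prop
  have hi : Integrable (fun p : E × ℝ =>
      (p.2 - ⟪ws, p.1⟫_ℝ) ^ 2 • InnerProductSpace.rankOne ℝ p.1 p.1) D :=
    Integrable.mono' h (aestronglyMeasurable_of_continuous (hc.smul continuous_rankOne_fst))
      (ae_of_all _ fun p => by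
        rw [norm_smul, InnerProductSpace.norm_rankOne, ← sq, Real.norm_of_nonneg (sq_nonneg _)])
  rw [gradCov, integral_inner_apply hi]
  simp_rw [smul_apply, InnerProductSpace.rankOne_apply, inner_smul_right,
    real_inner_comm _ v]
  exact integral_congr_ae (ae_of_all _ fun p => by ring)

lemma inner_fourthOp_rankOne (h : Integrable (fun p : E × ℝ => ‖p.1‖ ^ 4) D) (u v : E) :
    ⟪v, fourthOp D (InnerProductSpace.rankOne ℝ u u) v⟫_ℝ
      = ∫ p, (⟪u, p.1⟫_ℝ * ⟪v, p.1⟫_ℝ) ^ 2 ∂D := by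
  have hc : Continuous fun p : E × ℝ => InnerProductSpace.rankOne ℝ p.1 p.1
      ∘L InnerProductSpace.rankOne ℝ u u ∘L InnerProductSpace.rankOne ℝ p.1 p.1 :=
    continuous_rankOne_fst.clm_comp (continuous_const.clm_comp continuous_rankOne_fst)
  have hi : Integrable (fun p : E × ℝ => InnerProductSpace.rankOne ℝ p.1 p.1
      ∘L InnerProductSpace.rankOne ℝ u u ∘L InnerProductSpace.rankOne ℝ p.1 p.1) D := by
    refine Integrable.mono' (h.const_mul (‖u‖ ^ 2)) (aestronglyMeasurable_of_continuous hc)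
      (ae_of_all _ fun p => ?_)
    refine (ContinuousLinearMap.opNorm_comp_le _ _).trans ?_
    refine (mul_le_mul_of_nonneg_left (ContinuousLinearMap.opNorm_comp_le _ _)
      (norm_nonneg _)).trans_eq ?_
    simp_rw [InnerProductSpace.norm_rankOne]
    ring
  rw [fourthOp, integral_inner_apply hi]
  refine integral_congr_ae (ae_of_all _ fun p => ?_)
  simp only [ContinuousLinearMap.comp_apply, InnerProductSpace.rankOne_apply, inner_smul_right,
    real_inner_comm]
  rw [real_inner_comm p.1 u, real_inner_comm p.1 v]
  ring

lemma inner_covOp_basis {d : ℕ∞} {e : HilbertBasis (Idx d) ℝ E} {lam : Idx d → ℝ}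
    (h : SecondMoment D e lam) (i : Idx d) (v : E) :
    ⟪e i, covOp D v⟫_ℝ = lam i * ⟪e i, v⟫_ℝ := by
  have := inner_covOp h.integrable_sq v (e i)
  rw [h.eigen, inner_smul_right] at this
  rw [inner_covOp h.integrable_sq, real_inner_comm, this]
  simp_rw [mul_comm]

lemma hasSum_inner_covOp {d : ℕ∞} {e : HilbertBasis (Idx d) ℝ E} {lam : Idx d → ℝ}
    (h : SecondMoment D e lam) (v : E) :
    HasSum (fun i => lam i * ⟪e i, v⟫_ℝ ^ 2) ⟪v, covOp D v⟫_ℝ := by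
  have e1 : (fun i => lam i * ⟪e i, v⟫_ℝ ^ 2)
      = fun i => ⟪v, e i⟫_ℝ * ⟪e i, covOp D v⟫_ℝ := by
    funext i
    rw [inner_covOp_basis h, real_inner_comm]
    ring
  rw [e1]
  exact e.hasSum_inner_mul_inner v (covOp D v)

lemma opTrace_covOp {d : ℕ∞} {e : HilbertBasis (Idx d) ℝ E} {lam : Idx d → ℝ}
    (h : SecondMoment D e lam) : opTrace e (covOp D) = ∑' i, lam i := by
  refine tsum_congr fun i => ?_
  rw [inner_covOp_basis h, real_inner_self_eq_norm_sq, e.orthonormal.1 i]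
  simp

lemma opTrace_covOp_comp_rankOne {d : ℕ∞} {e : HilbertBasis (Idx d) ℝ E} {lam : Idx d → ℝ}
    (h : SecondMoment D e lam) (u : E) :
    opTrace e (covOp D ∘L InnerProductSpace.rankOne ℝ u u) = ⟪u, covOp D u⟫_ℝ := by
  refine (tsum_congr fun i => ?_).trans (hasSum_inner_covOp h u).tsum_eq
  rw [ContinuousLinearMap.comp_apply, inner_covOp_basis h, InnerProductSpace.rankOne_apply,
    inner_smul_right, real_inner_comm]
  ring

/-- The fourth moment assumption for an operator of rank one. -/
lemma integral_sq_inner_mul_inner_le {d : ℕ∞} {e : HilbertBasis (Idx d) ℝ E} {lam : Idx d → ℝ}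
    (h : SecondMoment D e lam) (h4 : FourthMoment D e ψ) (u v : E) :
    ∫ p, (⟪u, p.1⟫_ℝ * ⟪v, p.1⟫_ℝ) ^ 2 ∂D ≤ ψ * ⟪u, covOp D u⟫_ℝ * ⟪v, covOp D v⟫_ℝ := by
  have := (h4.le _ (InnerProductSpace.isPositive_rankOne_self u)).inner_nonneg_right v
  rw [sub_apply, inner_sub_right, inner_fourthOp_rankOne h4.integrable_fourth,
    opTrace_covOp_comp_rankOne h, smul_apply, inner_smul_right] at this
  linarith

lemma integral_sq_noise_le {d : ℕ∞} {e : HilbertBasis (Idx d) ℝ E} {lam : Idx d → ℝ} {ws : E}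
    (hlam : ∀ i, 0 < lam i) (h : WeakNoise D ws e lam σ) (i : Idx d) :
    ∫ p, ((p.2 - ⟪ws, p.1⟫_ℝ) * ⟪e i, p.1⟫_ℝ) ^ 2 ∂D ≤ σ ^ 2 * lam i := by
  obtain ⟨S, hS, hσ⟩ := h.level
  have h1 : ⟪e i, S (e i)⟫_ℝ ≤ σ ^ 2 := by
    rw [hσ]
    calc ⟪e i, S (e i)⟫_ℝ ≤ ‖e i‖ * ‖S (e i)‖ := real_inner_le_norm _ _
      _ ≤ ‖e i‖ * (‖S‖ * ‖e i‖) := by gcongr; exact S.le_opNorm _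
      _ = ‖S‖ := by rw [e.orthonormal.1 i]; simp
  rw [hS, mul_right_comm, ← mul_inv, Real.mul_self_sqrt (hlam i).le, inv_mul_le_iff₀ (hlam i),
    inner_gradCov h.integrable_noise] at h1
  rw [mul_comm (σ ^ 2)]
  refine le_trans (le_of_eq (integral_congr_ae (ae_of_all _ fun p => ?_))) h1
  ring

end Operators

/-! ### The stochastic gradient at a fixed point -/

/-- `η` is a label noise under which the stochastic gradients have mean zero at the minimizer `0`, and
covariance at most `s • H` in the directions `e i`. -/
structure CenteredNoise {E : Type*} [NormedAddCommGroup E] [InnerProductSpace ℝ E]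
    [MeasurableSpace E] {ι : Type*} (D : Measure (E × ℝ)) (e : HilbertBasis ι ℝ E) (lam : ι → ℝ)
    (s : ℝ) (η : E × ℝ → ℝ) : Prop where
  measurable : Measurable η
  integrable : Integrable (fun p => (η p * ‖p.1‖) ^ 2) D
  mean_zero : ∀ v, ∫ p, η p * ⟪v, p.1⟫_ℝ ∂D = 0
  cov_le : ∀ i, ∫ p, (η p * ⟪e i, p.1⟫_ℝ) ^ 2 ∂D ≤ s * lam i

section OneStep

set_option linter.unusedSectionVars false

variable {E : Type*} [NormedAddCommGroup E] [InnerProductSpace ℝ E] [CompleteSpace E]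
  [SecondCountableTopology E] [MeasurableSpace E] [BorelSpace E]
  {D : Measure (E × ℝ)} [IsProbabilityMeasure D] {d : ℕ∞} {e : HilbertBasis (Idx d) ℝ E}
  {lam : Idx d → ℝ} {ψ s : ℝ} {η : E × ℝ → ℝ}

lemma memLp_sq_norm (h4 : FourthMoment D e ψ) : MemLp (fun p : E × ℝ => ‖p.1‖ ^ 2) 2 D := by
  rw [memLp_two_iff_integrable_sq (by fun_prop)]
  simpa [← pow_mul] using h4.integrable_fourth

lemma memLp_inner_mul_inner (h4 : FourthMoment D e ψ) (u v : E) :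
    MemLp (fun p : E × ℝ => ⟪u, p.1⟫_ℝ * ⟪v, p.1⟫_ℝ) 2 D := by
  refine (memLp_sq_norm h4).of_le_mul (c := ‖u‖ * ‖v‖) (by fun_prop) (ae_of_all _ fun p => ?_)
  rw [norm_mul, Real.norm_of_nonneg (sq_nonneg ‖p.1‖)]
  calc ‖⟪u, p.1⟫_ℝ‖ * ‖⟪v, p.1⟫_ℝ‖ ≤ (‖u‖ * ‖p.1‖) * (‖v‖ * ‖p.1‖) := by
        gcongr <;> exact norm_inner_le_norm _ _
    _ = ‖u‖ * ‖v‖ * ‖p.1‖ ^ 2 := by ring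

lemma CenteredNoise.memLp_norm (hη : CenteredNoise D e lam s η) :
    MemLp (fun p => η p * ‖p.1‖) 2 D := by
  have := hη.measurable
  rw [memLp_two_iff_integrable_sq (by fun_prop)]
  exact hη.integrable

lemma CenteredNoise.memLp_inner (hη : CenteredNoise D e lam s η) (v : E) :
    MemLp (fun p => η p * ⟪v, p.1⟫_ℝ) 2 D := by
  have := hη.measurable
  refine hη.memLp_norm.of_le_mul (c := ‖v‖) (by fun_prop) (ae_of_all _ fun p => ?_)
  rw [norm_mul, norm_mul, norm_norm]
  calc ‖η p‖ * ‖⟪v, p.1⟫_ℝ‖ ≤ ‖η p‖ * (‖v‖ * ‖p.1‖) := by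
        gcongr; exact norm_inner_le_norm _ _
    _ = ‖v‖ * (‖η p‖ * ‖p.1‖) := by ring

/-- One step from a fixed position `v`: the deviation of the stochastic gradient from its mean is
uncorrelated with the constant `a`, and its variance is at most its second moment. The last term
vanishes on average over `v` if the mean of `v` does. -/
lemma integral_sq_step_le (h : SecondMoment D e lam) (h4 : FourthMoment D e ψ)
    (hη : CenteredNoise D e lam s η) (v : E) (a κ : ℝ) (i : Idx d) :
    ∫ p, (a + κ * (lam i * ⟪e i, v⟫_ℝ + (η p - ⟪v, p.1⟫_ℝ) * ⟪e i, p.1⟫_ℝ)) ^ 2 ∂D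
      ≤ a ^ 2 + κ ^ 2 * (lam i * (ψ * ⟪v, covOp D v⟫_ℝ + s)
        - 2 * ∫ p, ⟪v, p.1⟫_ℝ * (η p * ⟪e i, p.1⟫_ℝ * ⟪e i, p.1⟫_ℝ) ∂D) := by
  have m1 := memLp_inner_mul_inner h4 v (e i)
  have m2 := hη.memLp_inner (e i)
  have i1 := m1.integrable one_le_two
  have i2 := m2.integrable one_le_two
  have i3 := m1.integrable_sq
  have i4 := m2.integrable_sq
  have i5 : Integrable (fun p => ⟪v, p.1⟫_ℝ * (η p * ⟪e i, p.1⟫_ℝ * ⟪e i, p.1⟫_ℝ)) D :=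
    (m1.integrable_mul m2).congr (ae_of_all _ fun p => by simp only [Pi.mul_apply]; ring)
  have e1 : ∫ p, ⟪v, p.1⟫_ℝ * ⟪e i, p.1⟫_ℝ ∂D = lam i * ⟪e i, v⟫_ℝ := by
    rw [← inner_covOp h.integrable_sq, real_inner_comm, real_inner_comm, h.eigen, inner_smul_right,
      real_inner_comm]
  have e2 := hη.mean_zero (e i)
  have l3 : ∫ p, (⟪v, p.1⟫_ℝ * ⟪e i, p.1⟫_ℝ) ^ 2 ∂D ≤ ψ * ⟪v, covOp D v⟫_ℝ * lam i := by
    have := integral_sq_inner_mul_inner_le h h4 v (e i)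
    rwa [h.eigen, inner_smul_right, real_inner_self_eq_norm_sq, e.orthonormal.1 i, one_pow,
      mul_one] at this
  have l4 := hη.cov_le i
  set μ := lam i * ⟪e i, v⟫_ℝ
  have key : ∫ p, (a + κ * (μ + (η p - ⟪v, p.1⟫_ℝ) * ⟪e i, p.1⟫_ℝ)) ^ 2 ∂D
      = (a + κ * μ) ^ 2
        + 2 * (a + κ * μ) * κ * (∫ p, η p * ⟪e i, p.1⟫_ℝ ∂D - ∫ p, ⟪v, p.1⟫_ℝ * ⟪e i, p.1⟫_ℝ ∂D)
        + κ ^ 2 * (∫ p, (η p * ⟪e i, p.1⟫_ℝ) ^ 2 ∂D + ∫ p, (⟪v, p.1⟫_ℝ * ⟪e i, p.1⟫_ℝ) ^ 2 ∂D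
          - 2 * ∫ p, ⟪v, p.1⟫_ℝ * (η p * ⟪e i, p.1⟫_ℝ * ⟪e i, p.1⟫_ℝ) ∂D) := by
    have c : (a + κ * μ) ^ 2 = ∫ _, (a + κ * μ) ^ 2 ∂D := by simp
    rw [← integral_sub i2 i1, ← integral_add i4 i3, ← integral_const_mul 2,
      ← integral_sub (by exact i4.add i3) (i5.const_mul 2), ← integral_const_mul,
      ← integral_const_mul, c,
      ← integral_add (integrable_const _) (by exact (i2.sub i1).const_mul _),
      ← integral_add (by exact (integrable_const _).add ((i2.sub i1).const_mul _))
        (by exact ((i4.add i3).sub (i5.const_mul 2)).const_mul _)]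
    exact integral_congr_ae (ae_of_all _ fun p => by ring)
  rw [key, e1, e2]
  have := mul_le_mul_of_nonneg_left (add_le_add l4 l3) (sq_nonneg κ)
  nlinarith [sq_nonneg (κ * μ)]

/-! ### One step from a random position independent of the sample -/

variable {Ω : Type*} [MeasurableSpace Ω] {P : Measure Ω} [IsProbabilityMeasure P]
  {U : Ω → E} {Z : Ω → E × ℝ}

lemma integral_comp_indep {β : Type*} [MeasurableSpace β] {W : Ω → β} (hW : Measurable W)
    (hZ : Measurable Z) (hlaw : P.map Z = D) (hWZ : IndepFun W Z P) {G : β × (E × ℝ) → ℝ}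
    (hG : Measurable G) (hint : Integrable (fun ω => G (W ω, Z ω)) P) :
    Integrable (fun ω => ∫ p, G (W ω, p) ∂D) P
      ∧ ∫ ω, G (W ω, Z ω) ∂P = ∫ ω, ∫ p, G (W ω, p) ∂D ∂P := by
  have hD : IsProbabilityMeasure D := hlaw ▸ Measure.isProbabilityMeasure_map hZ.aemeasurable
  have hW' : IsProbabilityMeasure (P.map W) := Measure.isProbabilityMeasure_map hW.aemeasurable
  have hmap := (indepFun_iff_map_prod_eq_prod_map_map hW.aemeasurable hZ.aemeasurable).1 hWZ
  rw [hlaw] at hmap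
  have hi : Integrable G ((P.map W).prod D) := by
    rw [← hmap]
    exact (integrable_map_measure hG.aestronglyMeasurable (hW.prodMk hZ).aemeasurable).2 hint
  have hm : AEStronglyMeasurable (fun w => ∫ p, G (w, p) ∂D) (P.map W) :=
    hi.integral_prod_left.aestronglyMeasurable
  refine ⟨(integrable_map_measure hm hW.aemeasurable).1 hi.integral_prod_left, ?_⟩
  rw [← integral_map (f := G) (hW.prodMk hZ).aemeasurable hG.aestronglyMeasurable, hmap,
    integral_prod _ hi, integral_map hW.aemeasurable hm]

lemma memLp_norm_mul_of_indep {f : E × ℝ → ℝ} (hf : Measurable f) (hfD : MemLp f 2 D)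
    (hZ : Measurable Z) (hlaw : P.map Z = D) {A : Ω → ℝ} (hA : MemLp A 2 P)
    (hAZ : IndepFun A Z P) : MemLp (fun ω => A ω * f (Z ω)) 2 P := by
  have hfZ : MemLp (fun ω => f (Z ω)) 2 P := by
    rw [← hlaw] at hfD
    exact hfD.comp_of_map hZ.aemeasurable
  refine (memLp_two_iff_integrable_sq
    (hA.aestronglyMeasurable.mul hfZ.aestronglyMeasurable)).2 ?_
  have hind : IndepFun (fun ω => A ω ^ 2) (fun ω => f (Z ω) ^ 2) P :=
    hAZ.comp (φ := fun x => x ^ 2) (ψ := fun p => f p ^ 2) (by fun_prop) (by fun_prop)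
  refine (hind.integrable_mul hA.integrable_sq hfZ.integrable_sq).congr
    (ae_of_all _ fun ω => ?_)
  simp only [Pi.mul_apply]
  ring

lemma CenteredNoise.memLp_comp (hη : CenteredNoise D e lam s η) (hZ : Measurable Z)
    (hlaw : P.map Z = D) : MemLp (fun ω => η (Z ω) * ‖(Z ω).1‖) 2 P := by
  have := hη.memLp_norm
  rw [← hlaw] at this
  exact this.comp_of_map hZ.aemeasurable

/-- The stochastic gradient at a square integrable position independent of the sample is square
integrable. -/
lemma memLp_step (h4 : FourthMoment D e ψ) (hη : CenteredNoise D e lam s η)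
    (hU : Measurable U) (hU2 : MemLp U 2 P) (hZ : Measurable Z) (hlaw : P.map Z = D)
    (hUZ : IndepFun U Z P) :
    MemLp (fun ω => (η (Z ω) - ⟪U ω, (Z ω).1⟫_ℝ) • (Z ω).1) 2 P := by
  have hηm := hη.measurable
  have h1 : MemLp (fun ω => ‖U ω‖ * ‖(Z ω).1‖ ^ 2) 2 P :=
    memLp_norm_mul_of_indep (f := fun p => ‖p.1‖ ^ 2) (by fun_prop) (memLp_sq_norm h4) hZ hlaw
      hU2.norm (hUZ.comp measurable_norm measurable_id)
  refine ((hη.memLp_comp hZ hlaw).norm.add h1).of_le (by fun_prop) (ae_of_all _ fun ω => ?_)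
  refine le_trans ?_ (le_abs_self _)
  rw [norm_smul, Pi.add_apply, norm_mul, norm_norm]
  calc ‖η (Z ω) - ⟪U ω, (Z ω).1⟫_ℝ‖ * ‖(Z ω).1‖
      ≤ (‖η (Z ω)‖ + ‖U ω‖ * ‖(Z ω).1‖) * ‖(Z ω).1‖ := by
        gcongr
        exact (norm_sub_le _ _).trans (add_le_add le_rfl (norm_inner_le_norm _ _))
    _ = ‖η (Z ω)‖ * ‖(Z ω).1‖ + ‖U ω‖ * ‖(Z ω).1‖ ^ 2 := by ring

lemma integrable_inner_covOp (hU2 : MemLp U 2 P) :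
    Integrable (fun ω => ⟪U ω, covOp D (U ω)⟫_ℝ) P := by
  refine Integrable.mono' ((hU2.norm.integrable_sq).const_mul ‖covOp D‖)
    (hU2.aestronglyMeasurable.inner
      ((covOp D).continuous.comp_aestronglyMeasurable hU2.aestronglyMeasurable))
    (ae_of_all _ fun ω => ?_)
  calc ‖⟪U ω, covOp D (U ω)⟫_ℝ‖ ≤ ‖U ω‖ * (‖covOp D‖ * ‖U ω‖) :=
        (norm_inner_le_norm _ _).trans (by gcongr; exact (covOp D).le_opNorm _)
    _ = _ := by ring

lemma hasSum_integral_inner_covOp (h : SecondMoment D e lam) (hU2 : MemLp U 2 P) :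
    HasSum (fun i => lam i * ∫ ω, ⟪e i, U ω⟫_ℝ ^ 2 ∂P) (∫ ω, ⟪U ω, covOp D (U ω)⟫_ℝ ∂P) := by
  have hi : ∀ i, Integrable (fun ω => ⟪e i, U ω⟫_ℝ ^ 2) P :=
    fun i => (hU2.const_inner (𝕜 := ℝ) (e i)).integrable_sq
  have hle : ∀ i, ∫ ω, ⟪e i, U ω⟫_ℝ ^ 2 ∂P ≤ ∫ ω, ‖U ω‖ ^ 2 ∂P := fun i => by
    refine integral_mono (hi i) hU2.norm.integrable_sq fun ω => ?_
    have := norm_inner_le_norm (𝕜 := ℝ) (e i) (U ω)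
    rw [e.orthonormal.1 i, one_mul] at this
    simpa using pow_le_pow_left₀ (norm_nonneg _) this 2
  have hs : Summable fun i => lam i * ∫ ω, ⟪e i, U ω⟫_ℝ ^ 2 ∂P :=
    Summable.of_nonneg_of_le
      (fun i => mul_nonneg (h.pos i).le (integral_nonneg fun ω => sq_nonneg _))
      (fun i => mul_le_mul_of_nonneg_left (hle i) (h.pos i).le) (h.summable.mul_right _)
  have hsum := hasSum_integral_of_summable_integral_norm (μ := P)
    (F := fun i ω => lam i * ⟪e i, U ω⟫_ℝ ^ 2) (fun i => (hi i).const_mul _) (by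
      refine hs.congr fun i => ?_
      rw [← integral_const_mul]
      refine integral_congr_ae (ae_of_all _ fun ω => ?_)
      exact (Real.norm_of_nonneg (mul_nonneg (h.pos i).le (sq_nonneg _))).symm)
  simp_rw [integral_const_mul, (hasSum_inner_covOp h _).tsum_eq] at hsum
  exact hsum

/-- The correlation of the noise with the multiplicative part of the stochastic gradient vanishes
for noiseless labels, and for a position with mean zero. -/
lemma integral_cross_eq_zero (h4 : FourthMoment D e ψ) (hη : CenteredNoise D e lam s η)
    (hU2 : MemLp U 2 P) (h0 : η = 0 ∨ ∀ v, ∫ ω, ⟪v, U ω⟫_ℝ ∂P = 0) (i : Idx d) :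
    Integrable (fun ω => ∫ p, ⟪U ω, p.1⟫_ℝ * (η p * ⟪e i, p.1⟫_ℝ * ⟪e i, p.1⟫_ℝ) ∂D) P
      ∧ ∫ ω, ∫ p, ⟪U ω, p.1⟫_ℝ * (η p * ⟪e i, p.1⟫_ℝ * ⟪e i, p.1⟫_ℝ) ∂D ∂P = 0 := by
  rcases h0 with rfl | h0
  · simp
  have hηm := hη.measurable
  have hi : Integrable (fun p => (η p * ⟪e i, p.1⟫_ℝ * ⟪e i, p.1⟫_ℝ) • p.1) D := by
    refine Integrable.mono' (hη.memLp_norm.norm.integrable_mul (memLp_sq_norm h4)) (by fun_prop)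
      (ae_of_all _ fun p => ?_)
    have := norm_inner_le_norm (𝕜 := ℝ) (e i) p.1
    rw [e.orthonormal.1 i, one_mul] at this
    rw [norm_smul, norm_mul, norm_mul, Pi.mul_apply, norm_mul, norm_norm]
    calc ‖η p‖ * ‖⟪e i, p.1⟫_ℝ‖ * ‖⟪e i, p.1⟫_ℝ‖ * ‖p.1‖
        ≤ ‖η p‖ * ‖p.1‖ * ‖p.1‖ * ‖p.1‖ := by gcongr
      _ = _ := by ring
  have e1 : ∀ v : E, ∫ p, ⟪v, p.1⟫_ℝ * (η p * ⟪e i, p.1⟫_ℝ * ⟪e i, p.1⟫_ℝ) ∂D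
      = ⟪∫ p, (η p * ⟪e i, p.1⟫_ℝ * ⟪e i, p.1⟫_ℝ) • p.1 ∂D, v⟫_ℝ := fun v => by
    rw [real_inner_comm, ← integral_inner hi v]
    simp_rw [inner_smul_right, mul_comm]
  simp_rw [e1]
  exact ⟨(hU2.const_inner (𝕜 := ℝ) _).integrable one_le_two, h0 _⟩

/-- One step from a random position `U` that is independent of the sample `Z`: the deviation of the
stochastic gradient from its conditional mean adds to the second moment of any `A` known before. -/
lemma integral_sq_step_le_of_indep (h : SecondMoment D e lam) (h4 : FourthMoment D e ψ)
    (hη : CenteredNoise D e lam s η) {A : Ω → ℝ} (hA : Measurable A) (hA2 : MemLp A 2 P)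
    (hU : Measurable U) (hU2 : MemLp U 2 P) (hZ : Measurable Z) (hlaw : P.map Z = D)
    (hind : IndepFun (fun ω => (A ω, U ω)) Z P)
    (h0 : η = 0 ∨ ∀ v, ∫ ω, ⟪v, U ω⟫_ℝ ∂P = 0) (κ : ℝ) (i : Idx d) :
    ∫ ω, (A ω + κ * (lam i * ⟪e i, U ω⟫_ℝ
        + (η (Z ω) - ⟪U ω, (Z ω).1⟫_ℝ) * ⟪e i, (Z ω).1⟫_ℝ)) ^ 2 ∂P
      ≤ ∫ ω, A ω ^ 2 ∂P
        + κ ^ 2 * (lam i * (ψ * (∑' j, lam j * ∫ ω, ⟪e j, U ω⟫_ℝ ^ 2 ∂P) + s)) := by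
  have hηm := hη.measurable
  have hUZ : IndepFun U Z P := hind.comp measurable_snd measurable_id
  have hm : MemLp (fun ω => A ω + κ * (lam i * ⟪e i, U ω⟫_ℝ
      + (η (Z ω) - ⟪U ω, (Z ω).1⟫_ℝ) * ⟪e i, (Z ω).1⟫_ℝ)) 2 P := by
    have := (memLp_step h4 hη hU hU2 hZ hlaw hUZ).const_inner (𝕜 := ℝ) (e i)
    simp_rw [inner_smul_right] at this
    exact hA2.add ((((hU2.const_inner (𝕜 := ℝ) (e i)).const_mul (lam i)).add this).const_mul κ)
  have hAU : Measurable fun ω => (A ω, U ω) := hA.prodMk hU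
  obtain ⟨hi, he⟩ := integral_comp_indep hAU hZ hlaw hind
    (G := fun q => (q.1.1 + κ * (lam i * ⟪e i, q.1.2⟫_ℝ
        + (η q.2 - ⟪q.1.2, q.2.1⟫_ℝ) * ⟪e i, q.2.1⟫_ℝ)) ^ 2) (by fun_prop) hm.integrable_sq
  obtain ⟨ci, ce⟩ := integral_cross_eq_zero h4 hη hU2 h0 i
  have hH := integrable_inner_covOp (D := D) hU2
  have hL : Integrable (fun ω => lam i * (ψ * ⟪U ω, covOp D (U ω)⟫_ℝ + s)) P :=
    ((hH.const_mul ψ).add (integrable_const s)).const_mul (lam i)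
  have hR : Integrable (fun ω => κ ^ 2 * (lam i * (ψ * ⟪U ω, covOp D (U ω)⟫_ℝ + s)
      - 2 * ∫ p, ⟪U ω, p.1⟫_ℝ * (η p * ⟪e i, p.1⟫_ℝ * ⟪e i, p.1⟫_ℝ) ∂D)) P :=
    (hL.sub (ci.const_mul 2)).const_mul (κ ^ 2)
  rw [he]
  refine (integral_mono hi (hA2.integrable_sq.add hR)
    fun ω => integral_sq_step_le h h4 hη (U ω) (A ω) κ i).trans_eq ?_
  rw [integral_add' hA2.integrable_sq hR, integral_const_mul, integral_sub hL (ci.const_mul 2),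
    integral_const_mul, integral_const_mul, ce, integral_add (hH.const_mul ψ) (integrable_const s),
    integral_const_mul, (hasSum_integral_inner_covOp h hU2).tsum_eq]
  simp

/-- A position with mean zero keeps mean zero. -/
lemma integral_inner_step_eq_zero (h : SecondMoment D e lam) (h4 : FourthMoment D e ψ)
    (hη : CenteredNoise D e lam s η)
    (hU : Measurable U) (hU2 : MemLp U 2 P) (hZ : Measurable Z) (hlaw : P.map Z = D)
    (hUZ : IndepFun U Z P) (h0 : ∀ v, ∫ ω, ⟪v, U ω⟫_ℝ ∂P = 0) (v : E) :
    ∫ ω, ⟪v, (η (Z ω) - ⟪U ω, (Z ω).1⟫_ℝ) • (Z ω).1⟫_ℝ ∂P = 0 := by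
  have hηm := hη.measurable
  have hm := (memLp_step h4 hη hU hU2 hZ hlaw hUZ).const_inner (𝕜 := ℝ) v
  rw [(integral_comp_indep hU hZ hlaw hUZ (G := fun q => ⟪v, (η q.2 - ⟪q.1, q.2.1⟫_ℝ) • q.2.1⟫_ℝ)
    (by fun_prop) (hm.integrable one_le_two)).2]
  have e1 : ∀ u : E, ∫ p, ⟪v, (η p - ⟪u, p.1⟫_ℝ) • p.1⟫_ℝ ∂D = -⟪covOp D v, u⟫_ℝ := fun u => by
    simp_rw [inner_smul_right, sub_mul]
    rw [integral_sub ((hη.memLp_inner v).integrable one_le_two)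
      ((memLp_inner_mul_inner h4 u v).integrable one_le_two), hη.mean_zero,
      ← inner_covOp h.integrable_sq, real_inner_comm, zero_sub]
  simp_rw [e1, integral_neg, h0, neg_zero]

end OneStep

/-! ### The iterates along independent samples -/

/-- The iterates of `sgd` along the random samples `z`, with the label of a sample replaced by the
noise `η`, that is, with minimizer `0`. -/
def noisyIter {Ω E : Type*} [NormedAddCommGroup E] [InnerProductSpace ℝ E] (δ : ℝ)
    (η : E × ℝ → ℝ) (u : E) (z : ℕ → Ω → E × ℝ) (t : ℕ) (ω : Ω) : E :=
  sgd δ u (fun k => ((z k ω).1, η (z k ω))) t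

/-- The averages of `noisyIter`. -/
def noisyAvg {Ω E : Type*} [NormedAddCommGroup E] [InnerProductSpace ℝ E] (δ α : ℝ)
    (η : E × ℝ → ℝ) (u : E) (z : ℕ → Ω → E × ℝ) (t : ℕ) (ω : Ω) : E :=
  ema α (sgd δ u (fun k => ((z k ω).1, η (z k ω)))) t

section Iterates

set_option linter.unusedSectionVars false

variable {E : Type*} [NormedAddCommGroup E] [InnerProductSpace ℝ E] [CompleteSpace E]
  [SecondCountableTopology E] [MeasurableSpace E] [BorelSpace E]
  {D : Measure (E × ℝ)} [IsProbabilityMeasure D] {d : ℕ∞} {e : HilbertBasis (Idx d) ℝ E}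
  {lam : Idx d → ℝ} {ψ s : ℝ} {η : E × ℝ → ℝ} {Ω : Type*} {z : ℕ → Ω → E × ℝ} {δ α : ℝ} {u : E}

lemma noisyIter_succ (t : ℕ) (ω : Ω) : noisyIter δ η u z (t + 1) ω = noisyIter δ η u z t ω
    + δ • ((η (z (t + 1) ω) - ⟪noisyIter δ η u z t ω, (z (t + 1) ω).1⟫_ℝ)
      • (z (t + 1) ω).1) := by
  rw [smul_smul]
  rfl

lemma noisyAvg_succ (t : ℕ) (ω : Ω) : noisyAvg δ α η u z (t + 1) ω
    = α • noisyAvg δ α η u z t ω + (1 - α) • noisyIter δ η u z t ω := rfl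

/-- The recursion of the iterate in an eigendirection: a contraction, and the deviation of the
stochastic gradient from its mean. -/
lemma inner_noisyIter_succ (t : ℕ) (ω : Ω) (i : Idx d) : ⟪e i, noisyIter δ η u z (t + 1) ω⟫_ℝ
    = (1 - δ * lam i) * ⟪e i, noisyIter δ η u z t ω⟫_ℝ
      + δ * (lam i * ⟪e i, noisyIter δ η u z t ω⟫_ℝ
        + (η (z (t + 1) ω) - ⟪noisyIter δ η u z t ω, (z (t + 1) ω).1⟫_ℝ)
          * ⟪e i, (z (t + 1) ω).1⟫_ℝ) := by
  rw [noisyIter_succ, inner_add_right, inner_smul_right, inner_smul_right]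
  ring

lemma measurable_noisy [MeasurableSpace Ω] (hη : Measurable η) (t : ℕ)
    (hz : ∀ k ≤ t, Measurable (z k)) :
    Measurable (noisyIter δ η u z t) ∧ Measurable (noisyAvg δ α η u z t) := by
  induction t with
  | zero => exact ⟨measurable_const, measurable_const⟩
  | succ t ih =>
    obtain ⟨h1, h2⟩ := ih fun k hk => hz k (hk.trans t.le_succ)
    have h3 := hz (t + 1) le_rfl
    constructor
    · simp_rw [funext fun ω => noisyIter_succ (δ := δ) (η := η) (u := u) (z := z) t ω]
      fun_prop
    · simp_rw [funext fun ω => noisyAvg_succ (δ := δ) (α := α) (η := η) (u := u) (z := z) t ω]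
      fun_prop

variable [MeasurableSpace Ω] {P : Measure Ω} [IsProbabilityMeasure P]

lemma indepFun_noisy (hη : Measurable η) (hz : ∀ t, Measurable (z t)) (hindep : iIndepFun z P)
    (t : ℕ) :
    IndepFun (fun ω => (noisyIter δ η u z t ω, noisyAvg δ α η u z t ω)) (z (t + 1)) P := by
  have hz' := fun k => (hz k).stronglyMeasurable
  have h := hindep.indep_comap_natural_of_lt hz' t.lt_succ_self
  have hle : MeasurableSpace.comap
      (fun ω => (noisyIter δ η u z t ω, noisyAvg δ α η u z t ω)) inferInstance
      ≤ Filtration.natural z hz' t := by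
    have hm := @measurable_noisy E _ _ _ _ _ _ η Ω z δ α u (Filtration.natural z hz' t) hη t
      fun k hk => (((Filtration.stronglyAdapted_natural hz') k).mono
        ((Filtration.natural z hz').mono hk)).measurable
    exact (hm.1.prodMk hm.2).comap_le
  exact (IndepFun_iff_Indep _ _ _).2 (indep_of_indep_of_le_right h hle).symm

lemma memLp_noisyIter (h4 : FourthMoment D e ψ) (hη : CenteredNoise D e lam s η)
    (hz : ∀ t, Measurable (z t)) (hindep : iIndepFun z P) (hlaw : ∀ t, P.map (z t) = D) (t : ℕ) :
    MemLp (noisyIter δ η u z t) 2 P := by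
  induction t with
  | zero => exact memLp_const u
  | succ t ih =>
    have hm := (measurable_noisy (δ := δ) (α := 0) (u := u) hη.measurable t fun k _ => hz k).1
    have hi := (indepFun_noisy (δ := δ) (α := 0) (u := u) hη.measurable hz hindep t).comp
      measurable_fst measurable_id
    have := ih.add ((memLp_step h4 hη hm ih (hz (t + 1)) (hlaw (t + 1)) hi).const_smul δ)
    rw [funext fun ω => noisyIter_succ (δ := δ) (η := η) (u := u) (z := z) t ω]
    exact this

lemma memLp_noisyAvg (h4 : FourthMoment D e ψ) (hη : CenteredNoise D e lam s η)
    (hz : ∀ t, Measurable (z t)) (hindep : iIndepFun z P) (hlaw : ∀ t, P.map (z t) = D) (t : ℕ) :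
    MemLp (noisyAvg δ α η u z t) 2 P := by
  induction t with
  | zero => exact memLp_const u
  | succ t ih =>
    exact (ih.const_smul α).add ((memLp_noisyIter h4 hη hz hindep hlaw t).const_smul (1 - α))

lemma integral_inner_noisyIter_eq_zero (h : SecondMoment D e lam) (h4 : FourthMoment D e ψ)
    (hη : CenteredNoise D e lam s η) (hz : ∀ t, Measurable (z t)) (hindep : iIndepFun z P)
    (hlaw : ∀ t, P.map (z t) = D) (t : ℕ) (v : E) :
    ∫ ω, ⟪v, noisyIter δ η 0 z t ω⟫_ℝ ∂P = 0 := by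
  induction t generalizing v with
  | zero => simp [noisyIter, sgd]
  | succ t ih =>
    have hm := (measurable_noisy (δ := δ) (α := 0) (u := 0) hη.measurable t fun k _ => hz k).1
    have hi := (indepFun_noisy (δ := δ) (α := 0) (u := 0) hη.measurable hz hindep t).comp
      measurable_fst measurable_id
    have h2 := memLp_noisyIter (δ := δ) (u := 0) h4 hη hz hindep hlaw t
    have h3 := memLp_step h4 hη hm h2 (hz (t + 1)) (hlaw (t + 1)) hi
    simp_rw [noisyIter_succ, inner_add_right, inner_smul_right _ _ δ]
    rw [integral_add ((h2.const_inner v).integrable one_le_two)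
      (((h3.const_inner v).integrable one_le_two).const_mul δ), ih, integral_const_mul,
      integral_inner_step_eq_zero h h4 hη hm h2 (hz (t + 1)) (hlaw (t + 1)) hi ih, mul_zero,
      add_zero]

/-- One step of a linear functional of the current iterate and the current average. -/
lemma integral_sq_noisy_step_le (h : SecondMoment D e lam) (h4 : FourthMoment D e ψ)
    (hη : CenteredNoise D e lam s η) (hz : ∀ t, Measurable (z t)) (hindep : iIndepFun z P)
    (hlaw : ∀ t, P.map (z t) = D) (h0 : η = 0 ∨ u = 0) (t : ℕ) (i : Idx d) (a b κ : ℝ) :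
    ∫ ω, (a * ⟪e i, noisyAvg δ α η u z t ω⟫_ℝ + b * ⟪e i, noisyIter δ η u z t ω⟫_ℝ
        + κ * (lam i * ⟪e i, noisyIter δ η u z t ω⟫_ℝ
          + (η (z (t + 1) ω) - ⟪noisyIter δ η u z t ω, (z (t + 1) ω).1⟫_ℝ)
            * ⟪e i, (z (t + 1) ω).1⟫_ℝ)) ^ 2 ∂P
      ≤ ∫ ω, (a * ⟪e i, noisyAvg δ α η u z t ω⟫_ℝ + b * ⟪e i, noisyIter δ η u z t ω⟫_ℝ) ^ 2 ∂P
        + κ ^ 2 * (lam i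
          * (ψ * (∑' j, lam j * ∫ ω, ⟪e j, noisyIter δ η u z t ω⟫_ℝ ^ 2 ∂P) + s)) := by
  obtain ⟨hU, hV⟩ := measurable_noisy (δ := δ) (α := α) (u := u) hη.measurable t fun k _ => hz k
  have hU2 := memLp_noisyIter (δ := δ) (u := u) h4 hη hz hindep hlaw t
  have hV2 := memLp_noisyAvg (δ := δ) (α := α) (u := u) h4 hη hz hindep hlaw t
  refine integral_sq_step_le_of_indep h h4 hη
    (A := fun ω => a * ⟪e i, noisyAvg δ α η u z t ω⟫_ℝ + b * ⟪e i, noisyIter δ η u z t ω⟫_ℝ)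
    (by fun_prop) (((hV2.const_inner (e i)).const_mul a).add ((hU2.const_inner (e i)).const_mul b))
    hU hU2 (hz (t + 1)) (hlaw (t + 1)) ?_ ?_ κ i
  · exact (indepFun_noisy (δ := δ) (α := α) (u := u) hη.measurable hz hindep t).comp
      (φ := fun q : E × E => (a * ⟪e i, q.2⟫_ℝ + b * ⟪e i, q.1⟫_ℝ, q.1))
      (by fun_prop) measurable_id
  · refine h0.imp id ?_
    rintro rfl
    exact integral_inner_noisyIter_eq_zero h h4 hη hz hindep hlaw t

lemma momentRecursion_noisyIter (h : SecondMoment D e lam) (h4 : FourthMoment D e ψ)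
    (hη : CenteredNoise D e lam s η) (hz : ∀ t, Measurable (z t)) (hindep : iIndepFun z P)
    (hlaw : ∀ t, P.map (z t) = D) (h0 : η = 0 ∨ u = 0) :
    MomentRecursion lam ψ δ s fun t i => ∫ ω, ⟪e i, noisyIter δ η u z t ω⟫_ℝ ^ 2 ∂P where
  nonneg t i := integral_nonneg fun ω => sq_nonneg _
  summable t := (hasSum_integral_inner_covOp h
    (memLp_noisyIter h4 hη hz hindep hlaw t)).summable
  step t i := by
    have := integral_sq_noisy_step_le (δ := δ) (α := 0) h h4 hη hz hindep hlaw h0 t i 0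
      (1 - δ * lam i) δ
    simp_rw [zero_mul, zero_add, ← inner_noisyIter_succ, mul_pow, integral_const_mul,
      ← mul_assoc (δ ^ 2)] at this
    exact this

/-- The second moment of the average in an eigendirection: the response to the initial error, and
the responses to the deviations of the stochastic gradients from their means. -/
lemma integral_sq_inner_noisyAvg_le (h : SecondMoment D e lam) (h4 : FourthMoment D e ψ)
    (hη : CenteredNoise D e lam s η) (hz : ∀ t, Measurable (z t)) (hindep : iIndepFun z P)
    (hlaw : ∀ t, P.map (z t) = D) (h0 : η = 0 ∨ u = 0) (N : ℕ) (i : Idx d) :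
    ∫ ω, ⟪e i, noisyAvg δ α η u z N ω⟫_ℝ ^ 2 ∂P
      ≤ (decay δ α N (lam i) * ⟪e i, u⟫_ℝ) ^ 2
        + ∑ t ∈ Finset.range N, (δ * response α (1 - δ * lam i) (N - 1 - t)) ^ 2
          * (lam i
            * (ψ * (∑' j, lam j * ∫ ω, ⟪e j, noisyIter δ η u z t ω⟫_ℝ ^ 2 ∂P) + s)) := by
  -- By linearity, the conditional mean of the average `n` steps later is this combination of the
  -- average and the iterate at time `t`.
  have key : ∀ t n : ℕ, ∫ ω, (α ^ n * ⟪e i, noisyAvg δ α η u z t ω⟫_ℝ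
        + response α (1 - δ * lam i) n * ⟪e i, noisyIter δ η u z t ω⟫_ℝ) ^ 2 ∂P
      ≤ (decay δ α (n + t) (lam i) * ⟪e i, u⟫_ℝ) ^ 2
        + ∑ k ∈ Finset.range t, (δ * response α (1 - δ * lam i) (n + t - 1 - k)) ^ 2
          * (lam i
            * (ψ * (∑' j, lam j * ∫ ω, ⟪e j, noisyIter δ η u z k ω⟫_ℝ ^ 2 ∂P) + s)) := by
    intro t
    induction t with
    | zero =>
      intro n
      simp [noisyAvg, noisyIter, ema, sgd, decay_eq, add_mul]
    | succ t ih =>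
      intro n
      have h1 := integral_sq_noisy_step_le (δ := δ) (α := α) h h4 hη hz hindep hlaw h0 t i
        (α ^ (n + 1)) (response α (1 - δ * lam i) (n + 1)) (δ * response α (1 - δ * lam i) n)
      rw [Finset.sum_range_succ, ← add_assoc]
      have h2 := ih (n + 1)
      rw [show n + 1 + t = n + (t + 1) by ring] at h2
      have e1 : n + (t + 1) - 1 - t = n := by omega
      rw [e1]
      refine le_trans (le_of_eq (integral_congr_ae (ae_of_all _ fun ω => ?_)))
        (h1.trans (add_le_add h2 le_rfl))
      simp only [inner_noisyIter_succ (lam := lam), noisyAvg_succ, inner_add_right,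
        inner_smul_right _ _ α, inner_smul_right _ _ (1 - α), response]
      ring
  simpa [response] using key N 0

end Iterates

/-! ### The excess risk -/

section Risk

set_option linter.unusedSectionVars false

variable {E : Type*} [NormedAddCommGroup E] [InnerProductSpace ℝ E] [CompleteSpace E]
  [SecondCountableTopology E] [MeasurableSpace E] [BorelSpace E]
  {D : Measure (E × ℝ)} [IsProbabilityMeasure D] {d : ℕ∞} {e : HilbertBasis (Idx d) ℝ E}
  {lam : Idx d → ℝ} {ψ σ δ α : ℝ} {ws : E}

lemma memLp_inner_fst (hx : Integrable (fun p : E × ℝ => ‖p.1‖ ^ 2) D) (v : E) :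
    MemLp (fun p : E × ℝ => ⟪v, p.1⟫_ℝ) 2 D :=
  ((memLp_two_iff_integrable_sq_norm (f := fun p : E × ℝ => p.1)
    measurable_fst.aestronglyMeasurable).2 hx).const_inner v

lemma memLp_residual (hy : Integrable (fun p : E × ℝ => p.2 ^ 2) D)
    (hx : Integrable (fun p : E × ℝ => ‖p.1‖ ^ 2) D) (w : E) :
    MemLp (fun p : E × ℝ => p.2 - ⟪w, p.1⟫_ℝ) 2 D :=
  ((memLp_two_iff_integrable_sq measurable_snd.aestronglyMeasurable).2 hy).sub
    (memLp_inner_fst hx w)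

lemma risk_add (hy : Integrable (fun p : E × ℝ => p.2 ^ 2) D)
    (hx : Integrable (fun p : E × ℝ => ‖p.1‖ ^ 2) D) (w v : E) :
    risk D (w + v) = risk D w - (∫ p, (p.2 - ⟪w, p.1⟫_ℝ) * ⟪v, p.1⟫_ℝ ∂D)
      + 1 / 2 * ⟪v, covOp D v⟫_ℝ := by
  have m1 := memLp_residual hy hx w
  have m2 := memLp_inner_fst hx v
  have i1 := m1.integrable_sq
  have i2 : Integrable (fun p : E × ℝ => (p.2 - ⟪w, p.1⟫_ℝ) * ⟪v, p.1⟫_ℝ) D :=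
    m1.integrable_mul m2
  have i3 : Integrable (fun p : E × ℝ => ⟪v, p.1⟫_ℝ * ⟪v, p.1⟫_ℝ) D := m2.integrable_mul m2
  have key : ∫ p, (p.2 - ⟪w + v, p.1⟫_ℝ) ^ 2 ∂D = ∫ p, (p.2 - ⟪w, p.1⟫_ℝ) ^ 2 ∂D
      - 2 * (∫ p, (p.2 - ⟪w, p.1⟫_ℝ) * ⟪v, p.1⟫_ℝ ∂D)
      + ∫ p, ⟪v, p.1⟫_ℝ * ⟪v, p.1⟫_ℝ ∂D := by
    rw [← integral_const_mul, ← integral_sub i1 (i2.const_mul 2),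
      ← integral_add (by exact i1.sub (i2.const_mul 2)) i3]
    refine integral_congr_ae (ae_of_all _ fun p => ?_)
    simp only [inner_add_left]
    ring
  rw [risk, key, inner_covOp hx, risk]
  ring

lemma integral_residual_mul_inner_eq_zero (hy : Integrable (fun p : E × ℝ => p.2 ^ 2) D)
    (hx : Integrable (fun p : E × ℝ => ‖p.1‖ ^ 2) D) (hws : ∀ w, risk D ws ≤ risk D w) (v : E) :
    ∫ p, (p.2 - ⟪ws, p.1⟫_ℝ) * ⟪v, p.1⟫_ℝ ∂D = 0 := by
  set b := ∫ p, (p.2 - ⟪ws, p.1⟫_ℝ) * ⟪v, p.1⟫_ℝ ∂D with hb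
  have hquad : ∀ r : ℝ, 0 ≤ (1 / 2 * ⟪v, covOp D v⟫_ℝ) * (r * r) + (-b) * r + 0 := fun r => by
    have h1 := hws (ws + r • v)
    rw [risk_add hy hx] at h1
    simp only [inner_smul_left, map_smul, inner_smul_right, RCLike.conj_to_real,
      mul_left_comm _ r, integral_const_mul, ← hb] at h1
    linarith
  have := discrim_le_zero hquad
  rw [discrim] at this
  exact pow_eq_zero_iff two_ne_zero |>.1 (le_antisymm (by linarith) (sq_nonneg b))

lemma one_le_of_fourthMoment (h : SecondMoment D e lam) (h4 : FourthMoment D e ψ) (i : Idx d) :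
    1 ≤ ψ := by
  have hm := memLp_inner_mul_inner h4 (e i) (e i)
  have hH : ⟪e i, covOp D (e i)⟫_ℝ = lam i := by
    rw [inner_covOp_basis h, real_inner_self_eq_norm_sq, e.orthonormal.1 i]
    simp
  have h1 := integral_sq_inner_mul_inner_le h h4 (e i) (e i)
  have h2 := variance_nonneg (fun p : E × ℝ => ⟪e i, p.1⟫_ℝ * ⟪e i, p.1⟫_ℝ) D
  rw [variance_eq_sub hm, ← inner_covOp h.integrable_sq, hH] at h2
  simp only [Pi.pow_apply] at h2
  rw [hH] at h1
  have h3 : 1 * lam i ^ 2 ≤ ψ * lam i ^ 2 := by linarith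
  exact le_of_mul_le_mul_right h3 (pow_pos (h.pos i) 2)

lemma stepsize (h : SecondMoment D e lam) (h4 : FourthMoment D e ψ) (hδ : 0 < δ)
    (hδψ : δ < 1 / (ψ * opTrace e (covOp D))) : Stepsize lam ψ δ := by
  rw [opTrace_covOp h] at hδψ
  have hpos : 0 < ψ * ∑' i, lam i := one_div_pos.1 (hδ.trans hδψ)
  -- In the zero space the trace vanishes, which leaves no positive stepsize.
  have : Nonempty (Idx d) := by
    by_contra hne
    rw [not_nonempty_iff] at hne
    simp at hpos
  obtain ⟨i⟩ := this
  refine ⟨h.summable, fun i => (h.pos i).le, one_le_of_fourthMoment h h4 i, hδ, ?_⟩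
  rw [lt_div_iff₀ hpos] at hδψ
  linarith

lemma centeredNoise_zero : CenteredNoise D e lam 0 0 :=
  ⟨measurable_const, by simp, by simp, by simp⟩

lemma centeredNoise_residual (hy : Integrable (fun p : E × ℝ => p.2 ^ 2) D)
    (h : SecondMoment D e lam) (hn : WeakNoise D ws e lam σ) (hws : ∀ w, risk D ws ≤ risk D w) :
    CenteredNoise D e lam (σ ^ 2) fun p => p.2 - ⟪ws, p.1⟫_ℝ where
  measurable := by fun_prop
  integrable := by simpa [mul_pow] using hn.integrable_noise
  mean_zero := integral_residual_mul_inner_eq_zero hy h.integrable_sq hws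
  cov_le := integral_sq_noise_le h.pos hn

variable {Ω : Type*} {z : ℕ → Ω → E × ℝ}

/-- The error of the iterate splits into the error without noise and the error that is due to the
noise alone. -/
lemma sgd_eq_add (w0 : E) (t : ℕ) (ω : Ω) : sgd δ w0 (fun t => z t ω) t
    = ws + (noisyIter δ 0 (w0 - ws) z t ω
      + noisyIter δ (fun p => p.2 - ⟪ws, p.1⟫_ℝ) 0 z t ω) := by
  induction t with
  | zero => simp [noisyIter, sgd]
  | succ t ih =>
    rw [noisyIter_succ, noisyIter_succ, sgd, ih]
    simp only [inner_add_left, smul_smul, Pi.zero_apply]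
    module

lemma ema_sgd_eq_add (w0 : E) (t : ℕ) (ω : Ω) : ema α (sgd δ w0 (fun t => z t ω)) t
    = ws + (noisyAvg δ α 0 (w0 - ws) z t ω
      + noisyAvg δ α (fun p => p.2 - ⟪ws, p.1⟫_ℝ) 0 z t ω) := by
  induction t with
  | zero => simp [noisyAvg, ema, sgd]
  | succ t ih =>
    rw [noisyAvg_succ, noisyAvg_succ, ema, ih, sgd_eq_add (ws := ws)]
    module

lemma half_inner_covOp_add_le (h : SecondMoment D e lam) (u v : E) :
    1 / 2 * ⟪u + v, covOp D (u + v)⟫_ℝ ≤ ⟪u, covOp D u⟫_ℝ + ⟪v, covOp D v⟫_ℝ := by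
  refine hasSum_le (fun i => ?_) ((hasSum_inner_covOp h (u + v)).mul_left (1 / 2))
    ((hasSum_inner_covOp h u).add (hasSum_inner_covOp h v))
  rw [inner_add_right]
  nlinarith [mul_nonneg (h.pos i).le (sq_nonneg (⟪e i, u⟫_ℝ - ⟪e i, v⟫_ℝ))]

end Risk

end EMA

theorem theorem1 {E : Type*} [NormedAddCommGroup E] [InnerProductSpace ℝ E] [CompleteSpace E]
    [TopologicalSpace.SeparableSpace E] [MeasurableSpace E] [BorelSpace E]
    -- the data distribution, with a finite risk function minimized at `ws`
    (D : Measure (E × ℝ)) [IsProbabilityMeasure D]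
    (hy : Integrable (fun p : E × ℝ => p.2 ^ 2) D)
    (ws : E) (hws : ∀ w, EMA.risk D ws ≤ EMA.risk D w)
    -- the three moment assumptions
    (d : ℕ∞) (e : HilbertBasis (EMA.Idx d) ℝ E) (lam : EMA.Idx d → ℝ) (ψ σ : ℝ)
    (hsecond : EMA.SecondMoment D e lam)
    (hfourth : EMA.FourthMoment D e ψ)
    (hnoise : EMA.WeakNoise D ws e lam σ)
    -- i.i.d. samples from the data distribution
    {Ω : Type*} [MeasurableSpace Ω] (P : Measure Ω) [IsProbabilityMeasure P]
    (z : ℕ → Ω → E × ℝ) (hz : ∀ t, Measurable (z t)) (hindep : iIndepFun z P)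
    (hlaw : ∀ t, P.map (z t) = D)
    -- initialization and hyperparameters
    (w0 : E) (δ α : ℝ) (N : ℕ) (hδ : 0 < δ) (hα0 : 0 < α) (hα1 : α < 1)
    (hN : 1 ≤ N * (1 - α)) (hδψ : δ < 1 / (ψ * EMA.opTrace e (EMA.covOp D))) :
    Integrable (fun ω => EMA.risk D (EMA.ema α (EMA.sgd δ w0 (fun t => z t ω)) N)) P ∧
    ∫ ω, EMA.risk D (EMA.ema α (EMA.sgd δ w0 (fun t => z t ω)) N) ∂P - EMA.risk D ws
      ≤ EMA.effectiveBias lam (fun i => ⟪e i, w0 - ws⟫_ℝ) δ α N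
        + EMA.varBound lam (fun i => ⟪e i, w0 - ws⟫_ℝ)
            (EMA.opTrace e (EMA.covOp D)) ψ σ δ α N := by

  have : SecondCountableTopology E := UniformSpace.secondCountable_of_separable E
  have hl := EMA.stepsize hsecond hfourth hδ hδψ
  have hη0 : EMA.CenteredNoise D e lam 0 0 := EMA.centeredNoise_zero
  have hηξ := EMA.centeredNoise_residual hy hsecond hnoise hws
  set V := EMA.noisyAvg δ α (0 : E × ℝ → ℝ) (w0 - ws) z N
  set W := EMA.noisyAvg δ α (fun p : E × ℝ => p.2 - ⟪ws, p.1⟫_ℝ) 0 z N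
  have hV : MemLp V 2 P := EMA.memLp_noisyAvg hfourth hη0 hz hindep hlaw N
  have hW : MemLp W 2 P := EMA.memLp_noisyAvg hfourth hηξ hz hindep hlaw N
  have hrisk : ∀ ω, EMA.risk D (EMA.ema α (EMA.sgd δ w0 (fun t => z t ω)) N)
      = EMA.risk D ws + 1 / 2 * ⟪V ω + W ω, EMA.covOp D (V ω + W ω)⟫_ℝ := fun ω => by
    rw [EMA.ema_sgd_eq_add (ws := ws), EMA.risk_add hy hsecond.integrable_sq,
      EMA.integral_residual_mul_inner_eq_zero hy hsecond.integrable_sq hws, sub_zero]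
  have hint : Integrable (fun ω => 1 / 2 * ⟪V ω + W ω, EMA.covOp D (V ω + W ω)⟫_ℝ) P :=
    (EMA.integrable_inner_covOp (hV.add hW)).const_mul _
  simp_rw [hrisk]
  refine ⟨(integrable_const _).add hint, ?_⟩
  have hsV := EMA.hasSum_integral_inner_covOp hsecond hV
  have hsW := EMA.hasSum_integral_inner_covOp hsecond hW
  have hle : ∫ ω, 1 / 2 * ⟪V ω + W ω, EMA.covOp D (V ω + W ω)⟫_ℝ ∂P
      ≤ ∫ ω, ⟪V ω, EMA.covOp D (V ω)⟫_ℝ ∂P + ∫ ω, ⟪W ω, EMA.covOp D (W ω)⟫_ℝ ∂P := by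
    have iV := EMA.integrable_inner_covOp (D := D) hV
    have iW := EMA.integrable_inner_covOp (D := D) hW
    rw [← integral_add iV iW]
    exact integral_mono hint (iV.add iW) fun ω => EMA.half_inner_covOp_add_le hsecond _ _
  rw [← hsV.tsum_eq, ← hsW.tsum_eq] at hle
  have hbias := EMA.tsum_bias_le (N := N) (α := α) (v := fun i => ⟪e i, w0 - ws⟫_ℝ) hl
    (EMA.momentRecursion_noisyIter hsecond hfourth hη0 hz hindep hlaw (Or.inl rfl)) hα0.le hα1.le
    (by simpa using e.orthonormal.inner_products_summable (x := w0 - ws))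
    (fun i => by simp [EMA.noisyIter, EMA.sgd]) hsV.summable
    (EMA.integral_sq_inner_noisyAvg_le hsecond hfourth hη0 hz hindep hlaw (Or.inl rfl) N)
    (EMA.kStar lam δ α) (EMA.kDagger lam δ N)
  have hvar := EMA.tsum_noise_le (N := N) (α := α) hl
    (EMA.momentRecursion_noisyIter (u := 0) hsecond hfourth hηξ hz hindep hlaw (Or.inr rfl))
    (sq_nonneg σ) hα0.le hα1.le (fun i => by simp [EMA.noisyIter, EMA.sgd]) hsW.summable
    (fun i => by
      simpa using EMA.integral_sq_inner_noisyAvg_le hsecond hfourth hηξ hz hindep hlaw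
        (Or.inr rfl) N i)
    (EMA.kStar lam δ α) (EMA.kDagger lam δ N)
  rw [integral_add (integrable_const _) hint, EMA.opTrace_covOp hsecond, EMA.varBound]
  simp only [integral_const, probReal_univ, one_smul]
  linarith
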